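/- Let $\mathfrak S$ be the category of superschemes with the étale topology. A \emph{superstack} is a stack in groupoids over this site: a category $p\colon\mathfrak X\to\mathfrak S$ fibered in groupoids such that the isomorphisms between two objects of a fiber $\mathfrak X(\mathcal S)=p^{-1}(\mathcal S)$ form a sheaf and every descent datum is effective. A morphism of superstacks is a functor commuting with the projections to $\mathfrak S$. It is \emph{injective} if for every superscheme $\mathcal S$ the functor $\mathfrak X(\mathcal S)\to\mathfrak Y(\mathcal S)$ is fully faithful, and an equivalence if all these functors are equivalences of categories. A \emph{superspace} is a superstack equivalent to the one associated with a sheaf (of possibly large sets) on the étale site of superschemes. For morphisms $f\colon\mathfrak X\to\mathfrak Z$ and $g\colon\mathfrak Y\to\mathfrak Z$, the fiber product $\mathfrak X\times_{f,\mathfrak Z,g}\mathfrak Y$ has as objects over $\mathcal S$ the triples $(x,y,\alpha)$ with $x\in\mathfrak X(\mathcal S)$, $y\in\mathfrak Y(\mathcal S)$ and $\alpha\colon f(x)\to g(y)$ an isomorphism in $\mathfrak Z(\mathcal S)$; $\mathfrak X\times\mathfrak X$ is the fiber product over the terminal superstack $\mathfrak S\simeq\mathfrak S/\operatorname{Spec}\mathbb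 Z$. A morphism $f\colon\mathfrak X\to\mathfrak Y$ of superstacks is \emph{representable by superspaces} if for every superspace $\mathcal F$ and every morphism $g\colon\mathcal F\to\mathfrak Y$ the fiber product $\mathcal F\times_{g,\mathfrak Y,f}\mathfrak X$ is a superspace. Then: (1) A superstack $\mathfrak X$ is a superspace if and only if its diagonal $\Delta_{\mathfrak X}\colon\mathfrak X\to\mathfrak X\times\mathfrak X$ is injective. (2) A morphism $f\colon\mathfrak X\to\mathfrak Y$ of superstacks is representable by superspaces if and only if its relative diagonal $\Delta_f\colon\mathfrak X\to\mathfrak X\times_{\mathfrak Y}\mathfrak X$ is injective. -/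

import Mathlib

open CategoryTheory Opposite

universe u

noncomputable section

/-! ## Categories fibered in groupoids and stacks over a site -/

namespace FiberedStack

variable {C : Type (u + 1)} [Category.{u} C]

/-- The functor `f(S) : 𝒳(S) ⥤ 𝒴(S)` between fibre categories induced by a morphism
`f : 𝒳 ⥤ᵇ 𝒴` of categories over `C` (a functor strictly commuting with the projections). -/
def fiberMap {X Y : BasedCategory.{u, u + 1} C} (f : BasedFunctor X Y) (S : C) :
    X.p.Fiber S ⥤ Y.p.Fiber S where
  obj a := ⟨f.obj a.1, by rw [f.w_obj, a.2]⟩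
  map {a b} φ := ⟨f.map φ.1, by have := φ.2; infer_instance⟩
  map_id a := Subtype.ext (f.map_id a.1)
  map_comp φ ψ := Subtype.ext (f.map_comp φ.1 ψ.1)

/-- `𝒳` is a category fibered in groupoids over `C`. -/
structure IsFiberedInGroupoids (X : BasedCategory.{u, u + 1} C) : Prop where
  isFibered : X.p.IsFibered
  isGroupoid : ∀ S : C, IsGroupoid (X.p.Fiber S)

/-- The isomorphisms between two objects `x`, `y` of a fibre `𝒳(S)` form a sheaf.

A section of `Isom(x, y)` over `f : T ⟶ S` is a vertical arrow `f^* x ⟶ f^* y` (all vertical arrows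
are invertible), which is the same as an arrow `f^* x ⟶ y` lying over `f`. To avoid choosing a
pullback `f^* x`, a compatible family of sections over a sieve `R` on `S` is written as a family `ψ`
assigning to every arrow `a : x' ⟶ x` lying over an element of `R` (every such `a` exhibits `x'`
as the pullback of `x`) an arrow `ψ a : x' ⟶ y` lying over the same morphism of `C`, compatibly with
precomposition. The sheaf condition says that it is induced by a unique `φ : x ⟶ y` in `𝒳(S)`. -/
def IsomsFormSheaf (J : GrothendieckTopology C) (X : BasedCategory.{u, u + 1} C) : Prop :=
  ∀ (x y : X.obj) (_ : X.p.obj y = X.p.obj x) (R : Sieve (X.p.obj x)) (_ : R ∈ J (X.p.obj x))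
    (ψ : ∀ (x' : X.obj) (a : x' ⟶ x), R (X.p.map a) → (x' ⟶ y)),
    (∀ (x' : X.obj) (a : x' ⟶ x) (ha : R (X.p.map a)),
      X.p.IsHomLift (X.p.map a) (ψ x' a ha)) →
    (∀ (x' x'' : X.obj) (c : x'' ⟶ x') (a : x' ⟶ x) (ha : R (X.p.map a))
      (hca : R (X.p.map (c ≫ a))), ψ x'' (c ≫ a) hca = c ≫ ψ x' a ha) →
    ∃! φ : x ⟶ y, X.p.IsHomLift (𝟙 (X.p.obj x)) φ ∧
      ∀ (x' : X.obj) (a : x' ⟶ x) (ha : R (X.p.map a)), a ≫ φ = ψ x' a ha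

/-- A sieve `R` on `S` as a category over `C`: its objects are the elements `T ⟶ S` of `R` and
its morphisms are the morphisms over `S`. -/
abbrev sieveCategory {S : C} (R : Sieve S) : BasedCategory.{u, u + 1} C where
  obj := R.arrows.category
  p := R.arrows.diagram

/-- A descent datum in `𝒳` relative to the sieve `R` on `S`: an object `ξ_f ∈ 𝒳(T)` for every
`f : T ⟶ S` in `R` and, functorially, an arrow `ξ_{g ≫ f} ⟶ ξ_f` over `g` for every `g : T' ⟶ T`
(equivalently, isomorphisms `ξ_{g ≫ f} ≅ g^* ξ_f` with the cocycle condition). -/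
abbrev DescentDatum (X : BasedCategory.{u, u + 1} C) {S : C} (R : Sieve S) :=
  BasedFunctor (sieveCategory R) X

/-- A descent datum is effective if it comes from an object `x ∈ 𝒳(S)`: there are arrows
`ξ_f ⟶ x` over `f` (equivalently, isomorphisms `ξ_f ≅ f^* x`) compatible with the datum. -/
def DescentDatum.IsEffective {X : BasedCategory.{u, u + 1} C} {S : C} {R : Sieve S}
    (D : DescentDatum X R) : Prop :=
  ∃ (x : X.obj) (_ : X.p.obj x = S) (a : ∀ r : R.arrows.category, D.obj r ⟶ x),
    (∀ r : R.arrows.category, X.p.IsHomLift r.obj.hom (a r)) ∧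
    ∀ (r r' : R.arrows.category) (g : r ⟶ r'), D.map g ≫ a r' = a r

/-- `𝒳` is a stack (in groupoids) over the site `(C, J)`. -/
structure IsStack (J : GrothendieckTopology C) (X : BasedCategory.{u, u + 1} C) : Prop where
  isFiberedInGroupoids : IsFiberedInGroupoids X
  isomsFormSheaf : IsomsFormSheaf J X
  effective : ∀ (S : C) (R : Sieve S), R ∈ J S → ∀ D : DescentDatum X R, D.IsEffective

/-- A morphism is injective (a monomorphism) if it is fully faithful on all fibre categories. -/
def IsInjective {X Y : BasedCategory.{u, u + 1} C} (f : BasedFunctor X Y) : Prop :=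
  ∀ S : C, (fiberMap f S).Full ∧ (fiberMap f S).Faithful

/-- A morphism is an isomorphism (an equivalence of fibered categories) if it is an equivalence
on all fibre categories. -/
def IsIsomorphism {X Y : BasedCategory.{u, u + 1} C} (f : BasedFunctor X Y) : Prop :=
  ∀ S : C, (fiberMap f S).IsEquivalence

/-- The category fibered in sets over `C` associated with a presheaf `F`: the objects over `S` are
the elements of `F(S)`, and the morphisms `(S, s) ⟶ (T, t)` are the `φ : S ⟶ T` with
`F(φ)(t) = s`. -/
def ofPresheaf (F : Cᵒᵖ ⥤ Type (u + 1)) : BasedCategory.{u, u + 1} C where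
  obj := F.Elementsᵒᵖ
  p := (CategoryOfElements.π F).leftOp

/-- `𝒳` is a stack equivalent to the one associated with a sheaf on the site `(C, J)`. -/
structure IsSpace (J : GrothendieckTopology C) (X : BasedCategory.{u, u + 1} C) : Prop where
  isStack : IsStack J X
  exists_sheaf : ∃ F : Cᵒᵖ ⥤ Type (u + 1), Presieve.IsSheaf J F ∧
    ∃ e : BasedFunctor X (ofPresheaf F), IsIsomorphism e

section FiberProduct

variable {X Y Z : BasedCategory.{u, u + 1} C} (f : BasedFunctor X Z) (g : BasedFunctor Y Z)

/-- Objects of `𝒳 ×_{f, 𝒵, g} 𝒴`: quadruples `(S, x, y, α)` with `x ∈ 𝒳(S)`, `y ∈ 𝒴(S)` and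
`α : f(x) ≅ g(y)` an isomorphism in `𝒵(S)`. -/
structure FiberProductObj where
  base : C
  left : X.obj
  right : Y.obj
  left_over : X.p.obj left = base
  right_over : Y.p.obj right = base
  iso : f.obj left ≅ g.obj right
  iso_lift : Z.p.IsHomLift (𝟙 base) iso.hom

variable {f g} in
/-- Morphisms `(S, x, y, α) ⟶ (S', x', y', α')`: triples `(φ, u, v)` with `φ : S ⟶ S'`,
`u : x ⟶ x'` and `v : y ⟶ y'` lying over `φ`, and `α' ∘ f(u) = g(v) ∘ α`. -/
@[ext]
structure FiberProductHom (a b : FiberProductObj f g) where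
  base : a.base ⟶ b.base
  left : a.left ⟶ b.left
  right : a.right ⟶ b.right
  left_lift : X.p.IsHomLift base left
  right_lift : Y.p.IsHomLift base right
  comm : f.map left ≫ b.iso.hom = a.iso.hom ≫ g.map right

instance : Category (FiberProductObj f g) where
  Hom a b := FiberProductHom a b
  id a :=
    { base := 𝟙 a.base
      left := 𝟙 a.left
      right := 𝟙 a.right
      left_lift := IsHomLift.id a.left_over
      right_lift := IsHomLift.id a.right_over
      comm := by
        rw [f.map_id, g.map_id]
        exact (Category.id_comp _).trans (Category.comp_id _).symm }
  comp {a b c} φ ψ :=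
    { base := φ.base ≫ ψ.base
      left := φ.left ≫ ψ.left
      right := φ.right ≫ ψ.right
      left_lift := by have := φ.left_lift; have := ψ.left_lift; infer_instance
      right_lift := by have := φ.right_lift; have := ψ.right_lift; infer_instance
      comm := by
        rw [f.map_comp, g.map_comp, Category.assoc, ψ.comm, ← Category.assoc, φ.comm,
          Category.assoc] }
  id_comp φ := FiberProductHom.ext (Category.id_comp _) (Category.id_comp _) (Category.id_comp _)
  comp_id φ := FiberProductHom.ext (Category.comp_id _) (Category.comp_id _) (Category.comp_id _)
  assoc φ ψ χ := FiberProductHom.ext (Category.assoc _ _ _) (Category.assoc _ _ _)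
    (Category.assoc _ _ _)

/-- The fibre product `𝒳 ×_{f, 𝒵, g} 𝒴`. -/
def fiberProduct : BasedCategory.{u, u + 1} C where
  obj := FiberProductObj f g
  p :=
    { obj := fun a => a.base
      map := fun φ => FiberProductHom.base φ
      map_id := fun _ => rfl
      map_comp := fun _ _ => rfl }

end FiberProduct

/-- The relative diagonal `Δ_f : 𝒳 ⟶ 𝒳 ×_𝒴 𝒳`, `x ↦ (p(x), x, x, id)`, `u ↦ (p(u), u, u)`. -/
def relativeDiagonal {X Y : BasedCategory.{u, u + 1} C} (f : BasedFunctor X Y) :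
    BasedFunctor X (fiberProduct f f) where
  obj x := ⟨X.p.obj x, x, x, rfl, rfl, Iso.refl _, IsHomLift.id (f.w_obj x)⟩
  map u :=
    { base := X.p.map u
      left := u
      right := u
      left_lift := inferInstance
      right_lift := inferInstance
      comm := (Category.comp_id _).trans (Category.id_comp _).symm }
  map_id x := FiberProductHom.ext (X.p.map_id x) rfl rfl
  map_comp u w := FiberProductHom.ext (X.p.map_comp u w) rfl rfl
  w := rfl

/-- The terminal category over `C`, namely `C` itself. It is also the category over `C` associated
with any terminal object of `C`, as `C/T ≅ C` for a terminal object `T`. -/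
abbrev terminalBased (C : Type (u + 1)) [Category.{u} C] : BasedCategory.{u, u + 1} C where
  obj := C
  p := Functor.id C

/-- The structure morphism from `𝒳` to the terminal category over `C`. -/
def toTerminal (X : BasedCategory.{u, u + 1} C) : BasedFunctor X (terminalBased C) where
  toFunctor := X.p
  w := rfl

/-- The absolute product `𝒳 × 𝒴` of categories over `C`. -/
abbrev product (X Y : BasedCategory.{u, u + 1} C) : BasedCategory.{u, u + 1} C :=
  fiberProduct (toTerminal X) (toTerminal Y)

/-- The diagonal `Δ_𝒳 : 𝒳 ⟶ 𝒳 × 𝒳`. -/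
def diagonal (X : BasedCategory.{u, u + 1} C) : BasedFunctor X (product X X) :=
  relativeDiagonal (toTerminal X)

/-- `f : 𝒳 ⟶ 𝒴` is representable by spaces: for every space `ℱ` and every morphism `g : ℱ ⟶ 𝒴`,
the fibre product `ℱ ×_{g, 𝒴, f} 𝒳` is a space. -/
def IsRepresentableBySpaces (J : GrothendieckTopology C) {X Y : BasedCategory.{u, u + 1} C}
    (f : BasedFunctor X Y) : Prop :=
  ∀ (F : BasedCategory.{u, u + 1} C), IsSpace J F → ∀ g : BasedFunctor F Y,
    IsSpace J (fiberProduct g f)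

end FiberedStack

/-! ## Superrings -/

/-- A superring: a `ℤ/2`-graded ring which is supercommutative, that is, the even elements are
central and the odd elements have square zero (so odd elements anticommute with each other). -/
structure SuperRing : Type (u + 1) where
  carrier : Type u
  [ring : Ring carrier]
  /-- The homogeneous components. -/
  gr : ZMod 2 → AddSubgroup carrier
  [gradedMonoid : SetLike.GradedMonoid gr]
  isInternal : DirectSum.IsInternal gr
  even_comm : ∀ a ∈ gr 0, ∀ b, a * b = b * a
  odd_sq : ∀ a ∈ gr 1, a * a = 0

namespace SuperRing

instance : CoeSort SuperRing.{u} (Type u) := ⟨SuperRing.carrier⟩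

instance (A : SuperRing.{u}) : Ring A := A.ring

instance (A : SuperRing.{u}) : SetLike.GradedMonoid A.gr := A.gradedMonoid

/-- Morphisms of superrings: ring homomorphisms preserving the grading. -/
@[ext]
structure Hom (A B : SuperRing.{u}) where
  toRingHom : A →+* B
  map_mem : ∀ (i : ZMod 2) (a : A), a ∈ A.gr i → toRingHom a ∈ B.gr i

instance : Category SuperRing.{u} where
  Hom := Hom
  id A := ⟨RingHom.id A, fun _ _ h => h⟩
  comp f g := ⟨g.toRingHom.comp f.toRingHom, fun i _ h => g.map_mem i _ (f.map_mem i _ h)⟩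

/-- The ring homomorphism underlying a morphism of superrings. -/
abbrev ringHom {A B : SuperRing.{u}} (f : A ⟶ B) : A →+* B := Hom.toRingHom f

/-- The subring of even elements. -/
def even (A : SuperRing.{u}) : Subring A where
  carrier := A.gr 0
  mul_mem' {a b} ha hb := by
    have h := SetLike.GradedMul.mul_mem (A := A.gr) ha hb
    rwa [zero_add] at h
  one_mem' := SetLike.GradedOne.one_mem (A := A.gr)
  add_mem' ha hb := add_mem ha hb
  zero_mem' := zero_mem _
  neg_mem' ha := neg_mem ha

instance (A : SuperRing.{u}) : CommRing A.even :=
  { (inferInstance : Ring A.even) with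
    mul_comm := fun a b => Subtype.ext (A.even_comm a.1 a.2 b.1) }

/-- The even part of a superring, as a functor. -/
def evenPart : SuperRing.{u} ⥤ CommRingCat.{u} where
  obj A := CommRingCat.of A.even
  map {A B} f := CommRingCat.ofHom
    ((ringHom f).restrict A.even B.even (fun a ha => f.map_mem 0 a ha))

/-- The odd part of a superring, as a functor to abelian groups. -/
def oddPart : SuperRing.{u} ⥤ AddCommGrpCat.{u} where
  obj A := AddCommGrpCat.of (A.gr 1)
  map {A B} f := AddCommGrpCat.ofHom
    (((ringHom f).toAddMonoidHom.comp (A.gr 1).subtype).codRestrict (B.gr 1)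
      (fun a => f.map_mem 1 a.1 a.2))

/-- `ι : A ⟶ P` makes `P` the polynomial superalgebra `A[x₁, …, x_m | θ₁, …, θ_n]` with even
variables `x` and odd variables `θ`, expressed through its universal property. -/
structure IsPolynomialSuperalgebra {A P : SuperRing.{u}} (ι : A ⟶ P) {m n : ℕ}
    (x : Fin m → P) (θ : Fin n → P) : Prop where
  x_mem : ∀ i, x i ∈ P.gr 0
  θ_mem : ∀ j, θ j ∈ P.gr 1
  exists_unique : ∀ (D : SuperRing.{u}) (ψ : A ⟶ D) (c : Fin m → D) (γ : Fin n → D),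
    (∀ i, c i ∈ D.gr 0) → (∀ j, γ j ∈ D.gr 1) →
      ∃! χ : P ⟶ D, ι ≫ χ = ψ ∧ (∀ i, ringHom χ (x i) = c i) ∧ ∀ j, ringHom χ (θ j) = γ j

/-- `φ : A ⟶ B` makes `B` a finitely presented `A`-superalgebra: the quotient of a polynomial
superalgebra `A[x₁, …, x_m | θ₁, …, θ_n]` by a finitely generated ideal. -/
def IsFinitelyPresented {A B : SuperRing.{u}} (φ : A ⟶ B) : Prop :=
  ∃ (m n : ℕ) (P : SuperRing.{u}) (ι : A ⟶ P) (x : Fin m → P) (θ : Fin n → P) (π : P ⟶ B),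
    IsPolynomialSuperalgebra ι x θ ∧ ι ≫ π = φ ∧ Function.Surjective (ringHom π) ∧
      (RingHom.ker (ringHom π)).FG

/-- The kernel of the ring homomorphism is a nilpotent ideal: for some `k`, all products of `k`
elements of the kernel vanish. -/
def HasNilpotentKernel {A B : SuperRing.{u}} (φ : A ⟶ B) : Prop :=
  ∃ k : ℕ, ∀ a : Fin k → A, (∀ i, ringHom φ (a i) = 0) → (List.ofFn a).prod = 0

end SuperRing

/-! ## Superschemes -/

open AlgebraicGeometry TopologicalSpace

/-- A locally ringed superspace: a topological space with a sheaf of superrings (the even and the odd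
parts are sheaves) with local stalks. As odd elements are nilpotent, a superring is local if and
only if its even part is local. -/
structure LocallyRingedSuperspace : Type (u + 1) extends PresheafedSpace.{u, u + 1, u} SuperRing.{u} where
  isSheaf_even : TopCat.Presheaf.IsSheaf (X := carrier) (C := CommRingCat.{u}) (presheaf ⋙ SuperRing.evenPart)
  isSheaf_odd : TopCat.Presheaf.IsSheaf (X := carrier) (C := AddCommGrpCat.{u}) (presheaf ⋙ SuperRing.oddPart)
  isLocalRing_stalk : ∀ x : carrier,
    IsLocalRing (TopCat.Presheaf.stalk (X := carrier) (C := CommRingCat.{u})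
      (presheaf ⋙ SuperRing.evenPart) x)

namespace LocallyRingedSuperspace

/-- The locally ringed space `(X, 𝒪_{X,+})` given by the even part of the structure sheaf. -/
def ev (X : LocallyRingedSuperspace.{u}) : LocallyRingedSpace.{u} where
  toPresheafedSpace := SuperRing.evenPart.mapPresheaf.obj X.toPresheafedSpace
  IsSheaf := X.isSheaf_even
  isLocalRing := X.isLocalRing_stalk

/-- A morphism of locally ringed superspaces: a morphism of spaces with sheaves of superrings that is
local on stalks (which is a condition on the even part). -/
@[ext]
structure Hom (X Y : LocallyRingedSuperspace.{u}) where
  toHom : X.toPresheafedSpace ⟶ Y.toPresheafedSpace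
  isLocalHom : ∀ x : X.ev,
    IsLocalHom (PresheafedSpace.Hom.stalkMap
      (SuperRing.evenPart.mapPresheaf.map toHom : X.ev.toPresheafedSpace ⟶ _) x).hom

/-- The morphism induced on the even parts. -/
def Hom.ev {X Y : LocallyRingedSuperspace.{u}} (f : Hom X Y) : X.ev ⟶ Y.ev where
  toHom := SuperRing.evenPart.mapPresheaf.map f.toHom
  prop := f.isLocalHom

instance : Category LocallyRingedSuperspace.{u} where
  Hom := Hom
  id X :=
    { toHom := 𝟙 X.toPresheafedSpace
      isLocalHom := by
        have h : SuperRing.evenPart.mapPresheaf.map (𝟙 X.toPresheafedSpace) =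
            (𝟙 X.ev : X.ev ⟶ X.ev).toHom := SuperRing.evenPart.mapPresheaf.map_id _
        rw [h]
        exact (𝟙 X.ev : X.ev ⟶ X.ev).prop }
  comp {X Y Z} f g :=
    { toHom := f.toHom ≫ g.toHom
      isLocalHom := by
        have h : SuperRing.evenPart.mapPresheaf.map (f.toHom ≫ g.toHom) =
            (f.ev ≫ g.ev).toHom := SuperRing.evenPart.mapPresheaf.map_comp _ _
        rw [h]
        exact (f.ev ≫ g.ev).prop }
  id_comp f := Hom.ext (Category.id_comp _)
  comp_id f := Hom.ext (Category.comp_id _)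
  assoc f g h := Hom.ext (Category.assoc _ _ _)

end LocallyRingedSuperspace

namespace LocallyRingedSuperspace

/-- The superring `Γ(U, 𝒪_X)`. -/
def sections (X : LocallyRingedSuperspace.{u}) (U : Opens X.carrier) : SuperRing.{u} :=
  X.presheaf.obj (op U)

/-- The restriction `Γ(U, 𝒪_X) ⟶ Γ(V, 𝒪_X)` for `V ⊆ U`. -/
def restrict (X : LocallyRingedSuperspace.{u}) {U V : Opens X.carrier} (h : V ≤ U) :
    X.sections U →+* X.sections V :=
  SuperRing.ringHom (X.presheaf.map (homOfLE h).op)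

/-- `(X, 𝒪_{X,+})` is a scheme. -/
def IsEvenScheme (X : LocallyRingedSuperspace.{u}) : Prop :=
  ∀ x : X.ev, ∃ (U : OpenNhds x) (R : CommRingCat.{u}),
    Nonempty (X.ev.restrict U.isOpenEmbedding ≅ Spec.toLocallyRingedSpace.obj (op R))

/-- The scheme `(X, 𝒪_{X,+})`. -/
def evenScheme (X : LocallyRingedSuperspace.{u}) (h : X.IsEvenScheme) : Scheme.{u} where
  toLocallyRingedSpace := X.ev
  local_affine := h

/-- The open subset `D(s) ⊆ U` where the even section `s` over `U` is invertible. -/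
def basicOpen (X : LocallyRingedSuperspace.{u}) (h : X.IsEvenScheme) {U : Opens X.carrier}
    (s : (X.sections U).even) : Opens X.carrier :=
  Scheme.basicOpen (X.evenScheme h) (U := U) s

lemma basicOpen_le (X : LocallyRingedSuperspace.{u}) (h : X.IsEvenScheme) {U : Opens X.carrier}
    (s : (X.sections U).even) : X.basicOpen h s ≤ U :=
  Scheme.basicOpen_le (X.evenScheme h) (U := U) s

/-- The `𝒪_{X,+}`-module `𝒪_{X,-}` is quasi-coherent: for every affine open `U` and `s ∈ Γ(U, 𝒪_{X,+})`
the restriction `Γ(U, 𝒪_{X,-}) ⟶ Γ(D(s), 𝒪_{X,-})` is the localization at `s`. That is, every odd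
section on `D(s)` becomes, after multiplication by a power of `s`, the restriction of an odd section
on `U`, and every odd section on `U` that vanishes on `D(s)` is annihilated by a power of `s`. -/
structure IsOddQuasicoherent (X : LocallyRingedSuperspace.{u}) (h : X.IsEvenScheme) : Prop where
  exists_lift : ∀ (U : Opens X.carrier), IsAffineOpen (X := X.evenScheme h) U →
    ∀ (s : (X.sections U).even) (b : X.sections (X.basicOpen h s)),
      b ∈ (X.sections (X.basicOpen h s)).gr 1 →
        ∃ (k : ℕ) (a : X.sections U), a ∈ (X.sections U).gr 1 ∧
          X.restrict (X.basicOpen_le h s) a = X.restrict (X.basicOpen_le h s) s.1 ^ k * b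
  exists_pow_mul_eq_zero : ∀ (U : Opens X.carrier), IsAffineOpen (X := X.evenScheme h) U →
    ∀ (s : (X.sections U).even) (a : X.sections U), a ∈ (X.sections U).gr 1 →
      X.restrict (X.basicOpen_le h s) a = 0 → ∃ k : ℕ, s.1 ^ k * a = 0

end LocallyRingedSuperspace

/-- A superscheme: a locally ringed superspace `(X, 𝒪 = 𝒪_+ ⊕ 𝒪_-)` such that `(X, 𝒪_+)` is a scheme
and `𝒪_-` is a quasi-coherent `𝒪_+`-module. Equivalently, it is locally isomorphic to the spectrum of
a superring. -/
structure Superscheme : Type (u + 1) extends LocallyRingedSuperspace.{u} where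
  isEvenScheme : toLocallyRingedSuperspace.IsEvenScheme
  isOddQuasicoherent : toLocallyRingedSuperspace.IsOddQuasicoherent isEvenScheme

namespace Superscheme

/-- Superschemes form a full subcategory of locally ringed superspaces. -/
instance : Category Superscheme.{u} where
  Hom X Y := X.toLocallyRingedSuperspace ⟶ Y.toLocallyRingedSuperspace
  id X := 𝟙 X.toLocallyRingedSuperspace
  comp {X Y Z} f g := CategoryStruct.comp (X := X.toLocallyRingedSuperspace)
    (Y := Y.toLocallyRingedSuperspace) (Z := Z.toLocallyRingedSuperspace) f g
  id_comp f := Category.id_comp (obj := LocallyRingedSuperspace.{u}) f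
  comp_id f := Category.comp_id (obj := LocallyRingedSuperspace.{u}) f
  assoc f g h := Category.assoc (obj := LocallyRingedSuperspace.{u}) f g h

/-- The scheme `(X, 𝒪_{X,+})`. -/
abbrev evenScheme (X : Superscheme.{u}) : Scheme.{u} :=
  X.toLocallyRingedSuperspace.evenScheme X.isEvenScheme

/-- The continuous map underlying a morphism of superschemes. -/
def base {X Y : Superscheme.{u}} (f : X ⟶ Y) : X.carrier ⟶ Y.carrier :=
  (LocallyRingedSuperspace.Hom.toHom f).base

/-- The preimage of an open subset under a morphism of superschemes. -/
def preimage {X Y : Superscheme.{u}} (f : X ⟶ Y) (U : Opens Y.carrier) : Opens X.carrier :=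
  (Opens.map (base f)).obj U

/-- The superring morphism `Γ(U, 𝒪_Y) ⟶ Γ(V, 𝒪_X)` induced by `f : X ⟶ Y` for `V ⊆ f⁻¹(U)`. -/
def sectionsMap {X Y : Superscheme.{u}} (f : X ⟶ Y) (U : Opens Y.carrier)
    (V : Opens X.carrier) (h : V ≤ preimage f U) : Y.sections U ⟶ X.sections V :=
  (LocallyRingedSuperspace.Hom.toHom f).c.app (op U) ≫ X.presheaf.map (homOfLE h).op

/-- A superscheme is affine, that is, the spectrum of the superring of its global sections, if and
only if its even scheme is affine. -/
def IsAffine (X : Superscheme.{u}) : Prop :=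
  AlgebraicGeometry.IsAffine X.evenScheme

/-- For affine superschemes `T₀ = SSpec B₀` and `T = SSpec B`, the morphism `i : T₀ ⟶ T` is the closed
immersion defined by a nilpotent ideal `N ⊆ B`, so that `B₀ = B/N`. -/
structure IsAffineNilpotentImmersion {T₀ T : Superscheme.{u}} (i : T₀ ⟶ T) : Prop where
  isAffine_source : T₀.IsAffine
  isAffine_target : T.IsAffine
  surjective : Function.Surjective (SuperRing.ringHom (sectionsMap i ⊤ ⊤ le_rfl))
  nilpotent : SuperRing.HasNilpotentKernel (sectionsMap i ⊤ ⊤ le_rfl)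

/-- `f : X ⟶ S` is formally étale: for every affine `S`-superscheme `b : T = SSpec B ⟶ S` and every
nilpotent ideal `N ⊆ B`, the map `Hom_S(SSpec B, X) ⟶ Hom_S(SSpec (B/N), X)` is bijective. -/
def IsFormallyEtale {X S : Superscheme.{u}} (f : X ⟶ S) : Prop :=
  ∀ (T₀ T : Superscheme.{u}) (i : T₀ ⟶ T), IsAffineNilpotentImmersion i →
    ∀ (b : T ⟶ S) (a : T₀ ⟶ X), a ≫ f = i ≫ b → ∃! l : T ⟶ X, i ≫ l = a ∧ l ≫ f = b

/-- `f : X ⟶ S` is locally of finite presentation. -/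
def IsLocallyOfFinitePresentation {X S : Superscheme.{u}} (f : X ⟶ S) : Prop :=
  ∀ (U : Opens S.carrier) (V : Opens X.carrier) (h : V ≤ preimage f U),
    IsAffineOpen (X := S.evenScheme) U → IsAffineOpen (X := X.evenScheme) V →
       SuperRing.IsFinitelyPresented (sectionsMap f U V h)

/-- Étale morphisms of superschemes. -/
structure IsEtale {X S : Superscheme.{u}} (f : X ⟶ S) : Prop where
  isLocallyOfFinitePresentation : IsLocallyOfFinitePresentation f
  isFormallyEtale : IsFormallyEtale f

/-- Étale coverings: jointly surjective families of étale morphisms. -/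
def etalePrecoverage : Precoverage Superscheme.{u} where
  coverings S := {R | (∀ ⦃X : Superscheme.{u}⦄ (f : X ⟶ S), R f → IsEtale f) ∧
    ∀ s : S.carrier, ∃ (X : Superscheme.{u}) (f : X ⟶ S), R f ∧ s ∈ Set.range (base f)}

/-- The étale topology on the category of superschemes. -/
def etaleTopology : GrothendieckTopology Superscheme.{u} :=
  etalePrecoverage.toGrothendieck

end Superscheme

/-! ## Superstacks -/

/-- A superstack: a stack in groupoids over the étale site of superschemes. -/
abbrev IsSuperstack (X : BasedCategory.{u, u + 1} Superscheme.{u}) : Prop :=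
  FiberedStack.IsStack Superscheme.etaleTopology X

/-- A superspace: a superstack equivalent to the one associated with a sheaf on the étale site of
superschemes. -/
abbrev IsSuperspace (X : BasedCategory.{u, u + 1} Superscheme.{u}) : Prop :=
  FiberedStack.IsSpace Superscheme.etaleTopology X

/-- Morphisms of superstacks representable by superspaces. -/
abbrev IsRepresentableBySuperspaces {X Y : BasedCategory.{u, u + 1} Superscheme.{u}}
    (f : BasedFunctor X Y) : Prop :=
  FiberedStack.IsRepresentableBySpaces Superscheme.etaleTopology f

end

/-! Nothing below uses superschemes: both parts hold for stacks over any site (of the size fixed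
above).

In a category fibered in groupoids every arrow is cartesian, so arrows behave like monomorphisms
relative to the base. An arrow between diagonal objects is a pair of parallel arrows over one base
arrow with equal images under `f`, and the diagonal hits it exactly when the two agree. Hence `Δ_f`
is injective if and only if `f` is faithful on arrows over a fixed base arrow
(`isInjective_relativeDiagonal_iff`). Absolutely, this says that parallel arrows over the same base
arrow coincide: `HasThinFibers`.

For (1), a space has thin fibers because it embeds faithfully, fiber by fiber, in a category fibered
in sets. Conversely, thinness makes every coherence condition automatic. Local isomorphism classes
then form a descent datum, so the presheaf of isomorphism classes is a sheaf
(`IsStack.isSheaf_isoClasses`), and the stack is equivalent to it.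

For (2), if `f` is faithful and `F` is a space, then `F ×_Y X` is a stack with thin fibers, hence a
space by (1). Conversely, let `v, w : x ⟶ x'` agree in the base and in `Y`. The natural test object
is the slice of `Y` over `f(x')`, equivalent to the slice of the base, but it is a space only when
representables are sheaves. Instead `Hom(-, f(x'))` is sheafified on the total category of `Y`, and
its category of elements serves as test space. There `f(v) = f(w)` lifts to one arrow `m`, so `(m,
v)` and `(m, w)` are parallel arrows in a space and therefore equal. -/

namespace FiberedStack

variable {C : Type (u + 1)} [Category.{u} C] {X Y Z : BasedCategory.{u, u + 1} C}

/-! ### Lifting and factoring arrows in categories fibered in groupoids -/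

theorem isHomLift_iff_map_eq {x y : X.obj} (g : X.p.obj x ⟶ X.p.obj y) (φ : x ⟶ y) :
    X.p.IsHomLift g φ ↔ X.p.map φ = g :=
  ⟨fun _ => (IsHomLift.eq_of_isHomLift X.p g φ).symm, fun h => h ▸ inferInstance⟩

theorem isHomLift_iff_map_comp_eqToHom {x y : X.obj} {S T : C} (hx : X.p.obj x = S)
    (hy : X.p.obj y = T) (g : S ⟶ T) (φ : x ⟶ y) :
    X.p.IsHomLift g φ ↔ X.p.map φ ≫ eqToHom hy = eqToHom hx ≫ g := by
  subst hx hy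
  simp [isHomLift_iff_map_eq]

theorem map_map_eq (f : BasedFunctor X Y) {x y : X.obj} (u : x ⟶ y) :
    Y.p.map (f.map u) = eqToHom (f.w_obj x) ≫ X.p.map u ≫ eqToHom (f.w_obj y).symm :=
  Functor.congr_hom f.w u

namespace IsFiberedInGroupoids

variable (hX : IsFiberedInGroupoids X)
include hX

theorem exists_lift (x : X.obj) {T : C} (f : T ⟶ X.p.obj x) :
    ∃ (x' : X.obj) (e : X.p.obj x' = T) (a : x' ⟶ x), X.p.map a = eqToHom e ≫ f := by
  have := hX.isFibered
  obtain ⟨x', a, ha⟩ := IsPreFibered.exists_isCartesian X.p rfl f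
  have e := IsHomLift.domain_eq X.p f a
  subst e
  exact ⟨x', rfl, a, by simpa using (IsHomLift.eq_of_isHomLift X.p f a).symm⟩

theorem isIso_of_map_eq_id {x y : X.obj} {S : C} (φ : x ⟶ y) (hφ : X.p.IsHomLift (𝟙 S) φ) :
    IsIso φ := by
  have hx := IsHomLift.domain_eq X.p (𝟙 S) φ
  have hy := IsHomLift.codomain_eq X.p (𝟙 S) φ
  have := hX.isGroupoid S
  let ψ : Functor.Fiber.mk hx ⟶ Functor.Fiber.mk hy := ⟨φ, hφ⟩
  have : IsIso ψ := inferInstance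
  exact inferInstanceAs (IsIso (Functor.Fiber.fiberInclusion.map ψ))

/-- The comparison of `a` with a cartesian lift of the same base arrow is vertical, hence
invertible, so `a` is itself cartesian; in a fibered category this is the same as strongly
cartesian. All later factorizations rest on this. -/
theorem isStronglyCartesian {x' x : X.obj} (a : x' ⟶ x) :
    X.p.IsStronglyCartesian (X.p.map a) a := by
  have := hX.isFibered
  obtain ⟨b, φ, hφ⟩ := IsPreFibered.exists_isCartesian X.p rfl (X.p.map a)
  let χ := Functor.IsCartesian.map X.p (X.p.map a) φ a
  have hχ : IsIso χ := hX.isIso_of_map_eq_id (S := X.p.obj x') χ inferInstance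
  have hfac : χ ≫ φ = a := Functor.IsCartesian.fac X.p (X.p.map a) φ a
  have : X.p.IsCartesian (X.p.map a) ((asIso χ).hom ≫ φ) :=
    have : X.p.IsHomLift (𝟙 (X.p.obj x')) (asIso χ).hom :=
      inferInstanceAs (X.p.IsHomLift (𝟙 (X.p.obj x')) χ)
    Functor.IsCartesian.of_iso_comp X.p (X.p.map a) φ (asIso χ)
  have : X.p.IsCartesian (X.p.map a) a := by simpa [hfac] using this
  infer_instance

theorem existsUnique_factor {x' x z : X.obj} (a : x' ⟶ x) (b : z ⟶ x)
    (g : X.p.obj z ⟶ X.p.obj x') (w : g ≫ X.p.map a = X.p.map b) :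
    ∃! c : z ⟶ x', X.p.map c = g ∧ c ≫ a = b := by
  have := hX.isStronglyCartesian a
  have : X.p.IsHomLift (g ≫ X.p.map a) b := by rw [w]; infer_instance
  simpa only [isHomLift_iff_map_eq] using
    Functor.IsStronglyCartesian.universal_property' (p := X.p) (f := X.p.map a) (φ := a) g b

/-- The factorization of `b` through `a` over a factorization in the base. -/
noncomputable def factor {x' x z : X.obj} (a : x' ⟶ x) (b : z ⟶ x)
    (g : X.p.obj z ⟶ X.p.obj x') (w : g ≫ X.p.map a = X.p.map b) : z ⟶ x' :=
  (hX.existsUnique_factor a b g w).choose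

theorem map_factor {x' x z : X.obj} (a : x' ⟶ x) (b : z ⟶ x)
    (g : X.p.obj z ⟶ X.p.obj x') (w : g ≫ X.p.map a = X.p.map b) :
    X.p.map (hX.factor a b g w) = g :=
  (hX.existsUnique_factor a b g w).choose_spec.1.1

theorem factor_comp {x' x z : X.obj} (a : x' ⟶ x) (b : z ⟶ x)
    (g : X.p.obj z ⟶ X.p.obj x') (w : g ≫ X.p.map a = X.p.map b) :
    hX.factor a b g w ≫ a = b :=
  (hX.existsUnique_factor a b g w).choose_spec.1.2

/-- Uniqueness of cartesian factorizations, used as cancellation of `a` on the right. -/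
theorem hom_ext {x' x z : X.obj} (a : x' ⟶ x) {c c' : z ⟶ x'}
    (hp : X.p.map c = X.p.map c') (h : c ≫ a = c' ≫ a) : c = c' :=
  (hX.existsUnique_factor a (c' ≫ a) (X.p.map c') (by simp)).unique ⟨hp, h⟩ ⟨rfl, rfl⟩

/-- Two arrows with the same target and isomorphic images in the base differ by an arrow. -/
theorem exists_factor_of_eq {S : C} {x x' z : X.obj} (hx' : X.p.obj x' = S) (hz : X.p.obj z = S)
    (a : x' ⟶ x) (b : z ⟶ x) (w : eqToHom hx'.symm ≫ X.p.map a = eqToHom hz.symm ≫ X.p.map b) :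
    ∃ c : z ⟶ x', X.p.map c = eqToHom (hz.trans hx'.symm) ∧ c ≫ a = b := by
  subst hx'
  have w' : eqToHom hz ≫ X.p.map a = X.p.map b := by
    rw [← Category.id_comp (X.p.map a), ← eqToHom_refl _ rfl, w]; simp
  exact ⟨hX.factor a b _ w', hX.map_factor a b _ w', hX.factor_comp a b _ w'⟩

end IsFiberedInGroupoids

/-- The working criterion for constructed categories: lifts exist and every arrow has the cartesian
property. -/
theorem isFiberedInGroupoids_of_exists_lift_of_existsUnique_factor
    (hlift : ∀ (x : X.obj) (T : C) (f : T ⟶ X.p.obj x),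
      ∃ (x' : X.obj) (e : X.p.obj x' = T) (a : x' ⟶ x), X.p.map a = eqToHom e ≫ f)
    (hfac : ∀ (x' x z : X.obj) (a : x' ⟶ x) (b : z ⟶ x) (g : X.p.obj z ⟶ X.p.obj x'),
      g ≫ X.p.map a = X.p.map b → ∃! c : z ⟶ x', X.p.map c = g ∧ c ≫ a = b) :
    IsFiberedInGroupoids X where
  isFibered := by
    refine Functor.IsFibered.of_exists_isStronglyCartesian fun x T f => ?_
    obtain ⟨x', rfl, a, ha⟩ := hlift x T f
    obtain rfl : X.p.map a = f := by simpa using ha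
    refine ⟨x', a, ⟨fun {z} g b hb => ?_⟩⟩
    simpa only [isHomLift_iff_map_eq] using
      hfac x' x z a b g (IsHomLift.eq_of_isHomLift X.p _ b)
  isGroupoid S := by
    refine ⟨fun {x y} φ => ?_⟩
    obtain ⟨x, hx⟩ := x
    obtain ⟨y, hy⟩ := y
    obtain ⟨φ, hφ⟩ := φ
    change x ⟶ y at φ
    subst hx
    change X.p.IsHomLift _ φ at hφ
    have hφ' := (isHomLift_iff_map_comp_eqToHom rfl hy _ φ).1 hφ
    have h1 : X.p.map φ = eqToHom hy.symm := by
      rw [← cancel_mono (eqToHom hy), hφ']; simp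
    obtain ⟨ψ, ⟨hψ, hψφ⟩, -⟩ := hfac x y y φ (𝟙 y) (eqToHom hy) (by simp [h1])
    -- Factoring the identity through `φ` gave a one-sided inverse; the other side holds because `φ`
    -- factors uniquely through itself.
    have hφψ : φ ≫ ψ = 𝟙 x :=
      (hfac x y x φ φ (𝟙 _) (by simp)).unique
        ⟨by simp [h1, hψ], by rw [Category.assoc, hψφ, Category.comp_id]⟩ ⟨by simp, by simp⟩
    have hψl : X.p.IsHomLift (𝟙 (X.p.obj x)) ψ := by
      rw [isHomLift_iff_map_comp_eqToHom hy rfl, hψ]; simp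
    exact ⟨⟨ψ, hψl⟩, Subtype.ext hφψ, Subtype.ext hψφ⟩

/-! ### Injectivity of diagonals as faithfulness -/

/-- All arrows over a given arrow of the base with the same source and target coincide. -/
def HasThinFibers (X : BasedCategory.{u, u + 1} C) : Prop :=
  ∀ ⦃x y : X.obj⦄ (u v : x ⟶ y), X.p.map u = X.p.map v → u = v

/-- `f` is faithful on arrows over a given arrow of the base. -/
def IsFiberwiseFaithful (f : BasedFunctor X Y) : Prop :=
  ∀ ⦃x y : X.obj⦄ (u v : x ⟶ y), X.p.map u = X.p.map v → f.map u = f.map v → u = v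

/-- Parallel arrows over one base arrow differ by a vertical automorphism `w` of the source, and
cancelling the cartesian arrow `f(v)` shows `f(w) = 1`. -/
theorem IsFiberedInGroupoids.isFiberwiseFaithful_of_endomorphisms
    (hX : IsFiberedInGroupoids X) (hY : IsFiberedInGroupoids Y) (f : BasedFunctor X Y)
    (h : ∀ (x : X.obj) (w : x ⟶ x), X.p.map w = 𝟙 _ → f.map w = 𝟙 _ → w = 𝟙 x) :
    IsFiberwiseFaithful f := by
  intro x y u v hp hf
  obtain ⟨w, ⟨hw, hwv⟩, -⟩ := hX.existsUnique_factor v u (𝟙 _) (by simp [hp])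
  have hw' : w = 𝟙 x := by
    refine h x w hw (hY.hom_ext (f.map v) ?_ ?_)
    · simp [map_map_eq, hw]
    · rw [← f.map_comp, hwv, hf, Category.id_comp]
  rw [← hwv, hw', Category.id_comp]

theorem terminalBased_isFiberedInGroupoids : IsFiberedInGroupoids (terminalBased C) :=
  isFiberedInGroupoids_of_exists_lift_of_existsUnique_factor
    (fun _ T f => ⟨T, rfl, f, by simp⟩)
    (fun _ _ _ _ _ g w => ⟨g, ⟨rfl, w⟩, fun _ h => h.1⟩)

/-- The diagonal is always faithful, since the left component recovers an arrow; only fullness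
carries information. Fullness is needed only at pairs `(w, 𝟙)`, which come from an arrow of `X` only
if `w = 𝟙`. -/
theorem isInjective_relativeDiagonal_iff (hX : IsFiberedInGroupoids X)
    (hY : IsFiberedInGroupoids Y) (f : BasedFunctor X Y) :
    IsInjective (relativeDiagonal f) ↔ IsFiberwiseFaithful f := by
  constructor
  · refine fun h => hX.isFiberwiseFaithful_of_endomorphisms hY f fun x w hw hf => ?_
    have := (h (X.p.obj x)).1
    let x₀ : X.p.Fiber (X.p.obj x) := ⟨x, rfl⟩
    let m : (relativeDiagonal f).obj x ⟶ (relativeDiagonal f).obj x :=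
      { base := 𝟙 _
        left := w
        right := 𝟙 x
        left_lift := (isHomLift_iff_map_eq _ _).2 hw
        right_lift := (isHomLift_iff_map_eq _ _).2 (X.p.map_id x)
        comm := by
          change f.map w ≫ 𝟙 _ = 𝟙 _ ≫ f.map (𝟙 x)
          simp [hf] }
    let ψ : (fiberMap (relativeDiagonal f) (X.p.obj x)).obj x₀ ⟶
        (fiberMap (relativeDiagonal f) (X.p.obj x)).obj x₀ :=
      ⟨m, (isHomLift_iff_map_eq (X := fiberProduct f f) (x := (relativeDiagonal f).obj x)
        (y := (relativeDiagonal f).obj x) _ m).2 rfl⟩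
    obtain ⟨φ, hφ⟩ := (fiberMap (relativeDiagonal f) (X.p.obj x)).map_surjective ψ
    have h1 : (relativeDiagonal f).map φ.1 = m := congrArg Subtype.val hφ
    have h2 : φ.1 = w := congrArg FiberProductHom.left h1
    have h3 : φ.1 = 𝟙 x := congrArg FiberProductHom.right h1
    rw [← h2, h3]
  · refine fun h S => ⟨⟨fun {x y} ψ => ?_⟩, ⟨fun {x y} φ ψ hφψ => ?_⟩⟩
    · obtain ⟨x, rfl⟩ := x
      obtain ⟨y, hy⟩ := y
      obtain ⟨m, hm⟩ := ψ
      have hm' := (isHomLift_iff_map_comp_eqToHom (X := fiberProduct f f)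
          (x := (relativeDiagonal f).obj x) (y := (relativeDiagonal f).obj y) rfl hy _ m).1 hm
      obtain ⟨b, l, r, hl, hr, hc⟩ := m
      change X.p.obj x ⟶ X.p.obj y at b
      change x ⟶ y at l
      change x ⟶ y at r
      change X.p.IsHomLift b l at hl
      change X.p.IsHomLift b r at hr
      change f.map l ≫ 𝟙 _ = 𝟙 _ ≫ f.map r at hc
      change b ≫ eqToHom hy = 𝟙 _ ≫ 𝟙 _ at hm'
      have hl' : X.p.map l = b := (isHomLift_iff_map_eq _ _).1 hl
      have hr' : X.p.map r = b := (isHomLift_iff_map_eq _ _).1 hr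
      have hlr : l = r := h _ _ (hl'.trans hr'.symm) (by simpa using hc)
      have hlift : X.p.IsHomLift (𝟙 (X.p.obj x)) l := by
        rw [isHomLift_iff_map_comp_eqToHom rfl hy, hl', hm']; simp
      exact ⟨⟨l, hlift⟩, Subtype.ext (FiberProductHom.ext hl' rfl hlr)⟩
    · exact Subtype.ext (congrArg FiberProductHom.left (congrArg Subtype.val hφψ))

theorem hasThinFibers_iff_isFiberwiseFaithful_toTerminal :
    HasThinFibers X ↔ IsFiberwiseFaithful (toTerminal X) :=
  ⟨fun h _ _ u v hp _ => h u v hp, fun h _ _ u v hp => h u v hp hp⟩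

theorem isInjective_diagonal_iff (hX : IsFiberedInGroupoids X) :
    IsInjective (diagonal X) ↔ HasThinFibers X :=
  (isInjective_relativeDiagonal_iff hX terminalBased_isFiberedInGroupoids _).trans
    hasThinFibers_iff_isFiberwiseFaithful_toTerminal.symm

/-! ### The topology on the total category and gluing of arrows -/

/-- The arrows to `x` lying over a sieve on the image of `x` (which is `S`). -/
def sieveOver {x : X.obj} {S : C} (hx : X.p.obj x = S) (R : Sieve S) : Sieve x where
  arrows _ a := R (X.p.map a ≫ eqToHom hx)
  downward_closed {_ _ a} ha b := by
    simpa using R.downward_closed ha (X.p.map b)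

/-- The topology on the total category of a category fibered in groupoids: a sieve is covering if
it contains all arrows lying over some covering sieve of the base. -/
def totalTopology (J : GrothendieckTopology C) (hX : IsFiberedInGroupoids X) :
    GrothendieckTopology X.obj where
  sieves x := {W | ∃ R ∈ J (X.p.obj x), ∀ ⦃x' : X.obj⦄ (a : x' ⟶ x), R (X.p.map a) → W a}
  top_mem' x := ⟨⊤, J.top_mem _, fun _ _ _ => trivial⟩
  pullback_stable' := by
    rintro x x' W a ⟨R, hR, hW⟩
    exact ⟨R.pullback (X.p.map a), J.pullback_stable _ hR, fun x'' b hb => hW _ (by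
      simpa using hb)⟩
  transitive' := by
    rintro x W ⟨R, hR, hW⟩ V hV
    -- The witness is the sieve of base arrows factoring through the image of a member of `V`. It
    -- covers, as one sees by lifting base arrows; any arrow above it factors, being over such a
    -- composite, through a member of `V`.
    refine ⟨V.functorPushforward X.p, J.transitive hR _ fun T f hf => ?_, ?_⟩
    · obtain ⟨x', rfl, a, ha⟩ := hX.exists_lift x f
      obtain rfl : X.p.map a = f := by simpa using ha
      obtain ⟨R', hR', hV'⟩ := hV (hW a hf)
      refine J.superset_covering (fun T' k hk => ?_) hR'
      obtain ⟨x'', rfl, b, hb⟩ := hX.exists_lift x' k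
      obtain rfl : X.p.map b = k := by simpa using hb
      exact ⟨x'', b ≫ a, 𝟙 _, hV' b hk, by simp⟩
    · rintro x' a ⟨z, v, k, hv, hk⟩
      rw [← hX.factor_comp v a k hk.symm]
      exact V.downward_closed hv _

theorem sieveOver_mem {J : GrothendieckTopology C} (hX : IsFiberedInGroupoids X)
    {x : X.obj} {S : C} (hx : X.p.obj x = S) {R : Sieve S} (hR : R ∈ J S) :
    sieveOver hx R ∈ totalTopology J hX x := by
  subst hx
  exact ⟨R, hR, fun x' a ha => by simpa [sieveOver] using ha⟩

/-- A morphism of categories fibered in groupoids preserves covering sieves. -/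
theorem functorPushforward_mem {J : GrothendieckTopology C} (hX : IsFiberedInGroupoids X)
    (hY : IsFiberedInGroupoids Y) (f : BasedFunctor X Y) {x : X.obj} {W : Sieve x}
    (hW : W ∈ totalTopology J hX x) :
    W.functorPushforward f.toFunctor ∈ totalTopology J hY (f.obj x) := by
  obtain ⟨R, hR, hW⟩ := hW
  refine (totalTopology J hY).superset_covering (fun y b hb => ?_)
    (sieveOver_mem hY (f.w_obj x) hR)
  -- Once lifted to `a` in `X`, the base arrow of `b` is also that of `f(a)`, so `b` factors through
  -- `f(a)`.
  obtain ⟨x', e, a, ha⟩ := hX.exists_lift x (Y.p.map b ≫ eqToHom (f.w_obj x))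
  have hWa : W a := hW a (by rw [ha]; exact R.downward_closed hb _)
  obtain ⟨c, -, hc⟩ := hY.exists_factor_of_eq (S := Y.p.obj y) ((f.w_obj x').trans e) rfl
    (f.map a) b (by simp [map_map_eq, ha])
  exact ⟨x', a, c, hWa, hc.symm⟩

namespace IsStack

variable {J : GrothendieckTopology C} (hX : IsStack J X)
include hX

/-- The sheaf axiom speaks only of vertical arrows. Factoring everything through a pullback `b : y'
⟶ y` along `g` reduces arrows over `g` to that case. -/
theorem existsUnique_glue_of_base {x y : X.obj} (g : X.p.obj x ⟶ X.p.obj y)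
    {R : Sieve (X.p.obj x)} (hR : R ∈ J (X.p.obj x))
    (ψ : ∀ (x' : X.obj) (a : x' ⟶ x), R (X.p.map a) → (x' ⟶ y))
    (hψ : ∀ (x' : X.obj) (a : x' ⟶ x) (ha : R (X.p.map a)),
      X.p.map (ψ x' a ha) = X.p.map a ≫ g)
    (hcomp : ∀ (x' x'' : X.obj) (c : x'' ⟶ x') (a : x' ⟶ x) (ha : R (X.p.map a))
      (hca : R (X.p.map (c ≫ a))), ψ x'' (c ≫ a) hca = c ≫ ψ x' a ha) :
    ∃! φ : x ⟶ y, X.p.map φ = g ∧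
      ∀ (x' : X.obj) (a : x' ⟶ x) (ha : R (X.p.map a)), a ≫ φ = ψ x' a ha := by
  have hXg := hX.isFiberedInGroupoids
  obtain ⟨y', e, b, hb⟩ := hXg.exists_lift y g
  have w : ∀ (x' : X.obj) (a : x' ⟶ x) (ha : R (X.p.map a)),
      (X.p.map a ≫ eqToHom e.symm) ≫ X.p.map b = X.p.map (ψ x' a ha) := by
    intro x' a ha; simp [hb, hψ]
  obtain ⟨φ, ⟨hφ, hφψ⟩, hφu⟩ := hX.isomsFormSheaf x y' e R hR
    (fun x' a ha => hXg.factor b (ψ x' a ha) _ (w x' a ha))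
    (fun x' a ha => by
      rw [isHomLift_iff_map_comp_eqToHom rfl e, hXg.map_factor]; simp)
    (fun x' x'' c a ha hca => hXg.hom_ext b (by simp [hXg.map_factor])
      (by rw [Category.assoc, hXg.factor_comp, hXg.factor_comp, hcomp]))
  have hpφ : X.p.map φ = eqToHom e.symm := by
    have := (isHomLift_iff_map_comp_eqToHom rfl e _ φ).1 hφ
    rw [← cancel_mono (eqToHom e), this]; simp
  refine ⟨φ ≫ b, ⟨by simp [hpφ, hb], fun x' a ha => ?_⟩, fun φ' ⟨hp, h⟩ => ?_⟩
  · rw [← Category.assoc, hφψ x' a ha, hXg.factor_comp]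
  · have w' : eqToHom e.symm ≫ X.p.map b = X.p.map φ' := by simp [hb, hp]
    have : hXg.factor b φ' _ w' = φ := by
      refine hφu _ ⟨?_, fun x' a ha => hXg.hom_ext b ?_ ?_⟩
      · rw [isHomLift_iff_map_comp_eqToHom rfl e, hXg.map_factor]; simp
      · simp [hXg.map_factor]
      · rw [Category.assoc, hXg.factor_comp, hXg.factor_comp, h x' a ha]
    rw [← hXg.factor_comp b φ' _ w', this]

/-- Two arrows over the same arrow of the base which agree on a covering sieve are equal. -/
theorem hom_ext_of_mem {x y : X.obj} {φ φ' : x ⟶ y} (hp : X.p.map φ = X.p.map φ')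
    {W : Sieve x} (hW : W ∈ totalTopology J hX.isFiberedInGroupoids x)
    (h : ∀ ⦃x' : X.obj⦄ (a : x' ⟶ x), W a → a ≫ φ = a ≫ φ') : φ = φ' := by
  obtain ⟨R, hR, hRW⟩ := hW
  exact (hX.existsUnique_glue_of_base (X.p.map φ') hR (fun x' a _ => a ≫ φ') (by simp)
    (by simp)).unique ⟨hp, fun x' a ha => h a (hRW a ha)⟩ ⟨rfl, fun _ _ _ => rfl⟩

/-- Arrows defined compatibly on a covering sieve glue. -/
theorem exists_glue {x y : X.obj} (g : X.p.obj x ⟶ X.p.obj y) {W : Sieve x}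
    (hW : W ∈ totalTopology J hX.isFiberedInGroupoids x)
    (ψ : ∀ (x' : X.obj) (a : x' ⟶ x), W a → (x' ⟶ y))
    (hψ : ∀ (x' : X.obj) (a : x' ⟶ x) (ha : W a), X.p.map (ψ x' a ha) = X.p.map a ≫ g)
    (hcomp : ∀ (x' x'' : X.obj) (c : x'' ⟶ x') (a : x' ⟶ x) (ha : W a) (hca : W (c ≫ a)),
      ψ x'' (c ≫ a) hca = c ≫ ψ x' a ha) :
    ∃ φ : x ⟶ y, X.p.map φ = g ∧ ∀ (x' : X.obj) (a : x' ⟶ x) (ha : W a), a ≫ φ = ψ x' a ha := by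
  have hW' := hW
  obtain ⟨R, hR, hRW⟩ := hW
  obtain ⟨φ, ⟨hφ, hφψ⟩, -⟩ := hX.existsUnique_glue_of_base g hR
    (fun x' a ha => ψ x' a (hRW a ha)) (fun x' a ha => hψ x' a _)
    (fun x' x'' c a ha hca => hcomp x' x'' c a _ _)
  refine ⟨φ, hφ, fun x' a ha => ?_⟩
  -- The gluing prescribes `φ` only on arrows over `R`. For other members of `W`, agreement is
  -- checked locally, after pulling `R` back along `a`.
  refine hX.hom_ext_of_mem (W := (sieveOver rfl R).pullback a) (by simp [hφ, hψ])
    ((totalTopology J _).pullback_stable a (sieveOver_mem _ rfl hR)) fun x'' c hc => ?_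
  have hc' : R (X.p.map (c ≫ a)) := by simpa [sieveOver] using hc
  rw [← Category.assoc, hφψ _ _ hc', hcomp x' x'' c a ha]

end IsStack

/-- Gluing of arrows over arbitrary arrows of the base implies that the isomorphisms form a
sheaf. -/
theorem isomsFormSheaf_of_exists_glue {J : GrothendieckTopology C}
    (hsep : ∀ (x y : X.obj) (φ φ' : x ⟶ y), X.p.map φ = X.p.map φ' → ∀ R ∈ J (X.p.obj x),
      (∀ (x' : X.obj) (a : x' ⟶ x), R (X.p.map a) → a ≫ φ = a ≫ φ') → φ = φ')
    (hglue : ∀ (x y : X.obj) (g : X.p.obj x ⟶ X.p.obj y), ∀ R ∈ J (X.p.obj x),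
      ∀ ψ : (∀ (x' : X.obj) (a : x' ⟶ x), R (X.p.map a) → (x' ⟶ y)),
      (∀ (x' : X.obj) (a : x' ⟶ x) (ha : R (X.p.map a)),
        X.p.map (ψ x' a ha) = X.p.map a ≫ g) →
      (∀ (x' x'' : X.obj) (c : x'' ⟶ x') (a : x' ⟶ x) (ha : R (X.p.map a))
        (hca : R (X.p.map (c ≫ a))), ψ x'' (c ≫ a) hca = c ≫ ψ x' a ha) →
      ∃ φ : x ⟶ y, X.p.map φ = g ∧
        ∀ (x' : X.obj) (a : x' ⟶ x) (ha : R (X.p.map a)), a ≫ φ = ψ x' a ha) :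
    IsomsFormSheaf J X := by
  intro x y hxy R hR ψ hψ hcomp
  have hlift : ∀ φ : x ⟶ y, X.p.IsHomLift (𝟙 (X.p.obj x)) φ ↔ X.p.map φ = eqToHom hxy.symm := by
    intro φ
    rw [isHomLift_iff_map_comp_eqToHom rfl hxy, ← cancel_mono (eqToHom hxy)]; simp
  obtain ⟨φ, hφ, hφψ⟩ := hglue x y (eqToHom hxy.symm) R hR ψ (fun x' a ha => by
      have := (isHomLift_iff_map_comp_eqToHom rfl hxy _ _).1 (hψ x' a ha)
      rw [← cancel_mono (eqToHom hxy), this]; simp) hcomp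
  refine ⟨φ, ⟨(hlift φ).2 hφ, hφψ⟩, fun φ' ⟨hp, h⟩ => ?_⟩
  exact hsep x y φ' φ (((hlift φ').1 hp).trans hφ.symm) R hR fun x' a ha => by
    rw [h x' a ha, hφψ x' a ha]

theorem descentDatum_obj_over {S : C} {R : Sieve S} (D : DescentDatum X R)
    (r : R.arrows.category) : X.p.obj (D.obj r) = r.obj.left := D.w_obj r

theorem descentDatum_map_map {S : C} {R : Sieve S} (D : DescentDatum X R)
    {r r' : R.arrows.category} (k : r ⟶ r') :
    X.p.map (D.map k) = eqToHom (descentDatum_obj_over D r) ≫ k.hom.left ≫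
      eqToHom (descentDatum_obj_over D r').symm :=
  map_map_eq D k

/-- Arrows over the members of a sieve to an object `x` over `S`, compatible with a descent
datum `D`, exhibit every arrow to `x` over the sieve as factoring canonically through `D`. -/
theorem IsFiberedInGroupoids.exists_factor_descentDatum (hX : IsFiberedInGroupoids X) {S : C}
    {R : Sieve S} (D : DescentDatum X R) {x : X.obj} (hx : X.p.obj x = S)
    (a : ∀ r : R.arrows.category, D.obj r ⟶ x)
    (ha : ∀ r : R.arrows.category, X.p.IsHomLift r.obj.hom (a r))
    (hcomp : ∀ (r r' : R.arrows.category) (g : r ⟶ r'), D.map g ≫ a r' = a r) :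
    ∃ (r : ∀ (x' : X.obj) (v : x' ⟶ x), sieveOver hx R v → R.arrows.category)
      (c : ∀ (x' : X.obj) (v : x' ⟶ x) (hv : sieveOver hx R v), x' ⟶ D.obj (r x' v hv)),
      (∀ (x' : X.obj) (v : x' ⟶ x) (hv : sieveOver hx R v), c x' v hv ≫ a _ = v) ∧
      ∀ (x' : X.obj) (v : x' ⟶ x) (hv : sieveOver hx R v) (r₀ : R.arrows.category)
        (d : x' ⟶ D.obj r₀), d ≫ a r₀ = v → ∃ k : r x' v hv ⟶ r₀, c x' v hv ≫ D.map k = d := by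
  have hpa : ∀ r : R.arrows.category, X.p.map (a r) = eqToHom (descentDatum_obj_over D r) ≫ r.obj.hom ≫
      eqToHom hx.symm := fun r => have := ha r; IsHomLift.fac' X.p r.obj.hom (a r)
  let r : ∀ (x' : X.obj) (v : x' ⟶ x), sieveOver hx R v → R.arrows.category :=
    fun x' v hv => Presieve.categoryMk R.arrows (X.p.map v ≫ eqToHom hx) hv
  have hr : ∀ (x' : X.obj) (v : x' ⟶ x) (hv : sieveOver hx R v),
      (r x' v hv).obj.hom = X.p.map v ≫ eqToHom hx := fun _ _ _ => rfl
  have hfac : ∀ (x' : X.obj) (v : x' ⟶ x) (hv : sieveOver hx R v), ∃ c : x' ⟶ D.obj (r x' v hv),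
      X.p.map c = eqToHom (descentDatum_obj_over D (r x' v hv)).symm ∧ c ≫ a _ = v := by
    intro x' v hv
    have hw : eqToHom (descentDatum_obj_over D (r x' v hv)).symm ≫ X.p.map (a (r x' v hv)) =
        X.p.map v := by
      rw [hpa, hr]; simp
    exact ⟨hX.factor _ v _ hw, hX.map_factor _ v _ hw, hX.factor_comp _ v _ hw⟩
  choose c hpc hca using hfac
  refine ⟨r, c, hca, fun x' v hv r₀ d hd => ?_⟩
  -- The base arrow of `d` followed by that of `r₀` is the base arrow of `v`, so it is a morphism of
  -- the sieve category.
  let k : r x' v hv ⟶ r₀ := ObjectProperty.homMk (Over.homMk (X.p.map d ≫ eqToHom (descentDatum_obj_over D r₀)) (by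
    have := congrArg (fun f => X.p.map f ≫ eqToHom hx) hd
    simpa [hpa, r] using this))
  refine ⟨k, hX.hom_ext (a r₀) ?_ ?_⟩
  · rw [X.p.map_comp, hpc, descentDatum_map_map D k]
    simp [k]
  · rw [Category.assoc, hcomp, hca, hd]

/-- Arrows in a stack compatible with a descent datum glue. -/
theorem IsStack.exists_glue_descentDatum {J : GrothendieckTopology C} (hX : IsStack J X) {S : C}
    {R : Sieve S} (hR : R ∈ J S) (D : DescentDatum X R) {x y : X.obj} (hx : X.p.obj x = S)
    (hy : X.p.obj y = S) (a : ∀ r : R.arrows.category, D.obj r ⟶ x)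
    (ha : ∀ r : R.arrows.category, X.p.IsHomLift r.obj.hom (a r))
    (hacomp : ∀ (r r' : R.arrows.category) (g : r ⟶ r'), D.map g ≫ a r' = a r)
    (b : ∀ r : R.arrows.category, D.obj r ⟶ y)
    (hb : ∀ r : R.arrows.category, X.p.IsHomLift r.obj.hom (b r))
    (hbcomp : ∀ (r r' : R.arrows.category) (g : r ⟶ r'), D.map g ≫ b r' = b r) :
    ∃ φ : x ⟶ y, X.p.IsHomLift (𝟙 S) φ ∧ ∀ r, a r ≫ φ = b r := by
  have hpa : ∀ r : R.arrows.category, X.p.map (a r) = eqToHom (descentDatum_obj_over D r) ≫ r.obj.hom ≫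
      eqToHom hx.symm := fun r => have := ha r; IsHomLift.fac' X.p r.obj.hom (a r)
  have hpb : ∀ r : R.arrows.category, X.p.map (b r) = eqToHom (descentDatum_obj_over D r) ≫ r.obj.hom ≫
      eqToHom hy.symm := fun r => have := hb r; IsHomLift.fac' X.p r.obj.hom (b r)
  obtain ⟨r, c, hca, hc⟩ :=
    hX.isFiberedInGroupoids.exists_factor_descentDatum D hx a ha hacomp
  -- On an arrow `v` over the sieve, `φ` must be the canonical factor of `v` through `D` followed by
  -- `b`; `hc` makes this compatible with precomposition.
  obtain ⟨φ, hφ, hφψ⟩ := hX.exists_glue (eqToHom (hx.trans hy.symm))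
    (sieveOver_mem hX.isFiberedInGroupoids hx hR) (fun x' v hv => c x' v hv ≫ b _)
    (fun x' v hv => by
      conv_rhs => rw [← hca x' v hv]
      simp [hpa, hpb])
    (fun x' x'' e v hv hev => by
      obtain ⟨k, hk⟩ := hc x'' (e ≫ v) hev _ (e ≫ c x' v hv) (by rw [Category.assoc, hca])
      rw [← Category.assoc, ← hk, Category.assoc, hbcomp])
  refine ⟨φ, ?_, fun r₀ => ?_⟩
  · rw [isHomLift_iff_map_comp_eqToHom hx hy, hφ]; simp
  · have hv : sieveOver hx R (a r₀) := by
      change R (X.p.map (a r₀) ≫ eqToHom hx)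
      simpa [hpa] using R.downward_closed r₀.property (eqToHom (descentDatum_obj_over D r₀))
    obtain ⟨k, hk⟩ := hc _ (a r₀) hv r₀ (𝟙 _) (Category.id_comp _)
    rw [hφψ _ _ hv, ← hbcomp _ _ k, ← Category.assoc, hk, Category.id_comp]

/-! ### The sheaf of isomorphism classes and spaces as thin stacks -/

namespace IsFiberedInGroupoids

variable (hX : IsFiberedInGroupoids X)

/-- Pairs `(x, h : S ⟶ p(x))`, thought of as the pullbacks `h^* x`, up to isomorphism. -/
def isoClassSetoid (S : C) : Setoid (Σ x : X.obj, S ⟶ X.p.obj x) where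
  r s t := ∃ (z : X.obj) (a : z ⟶ s.1) (b : z ⟶ t.1) (e : S ⟶ X.p.obj z),
    e ≫ X.p.map a = s.2 ∧ e ≫ X.p.map b = t.2
  iseqv :=
    { refl := fun s => ⟨s.1, 𝟙 _, 𝟙 _, s.2, by simp, by simp⟩
      symm := fun ⟨z, a, b, e, ha, hb⟩ => ⟨z, b, a, e, hb, ha⟩
      trans := by
        -- Spans compose after lifting `e` to `c : w ⟶ z` with `w` over `S`: then `c ≫ b` factors
        -- through `a'`.
        rintro s t r ⟨z, a, b, e, ha, hb⟩ ⟨z', a', b', e', ha', hb'⟩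
        obtain ⟨w, rfl, c, hc⟩ := hX.exists_lift z e
        obtain rfl : X.p.map c = e := by simpa using hc
        have h : e' ≫ X.p.map a' = X.p.map (c ≫ b) := by rw [ha', ← hb, X.p.map_comp]
        exact ⟨w, c ≫ a, hX.factor a' (c ≫ b) e' h ≫ b', 𝟙 _, by simp [← ha],
          by simp [hX.map_factor, hb']⟩ }

/-- The presheaf of isomorphism classes of objects of the fibers. -/
def isoClasses : Cᵒᵖ ⥤ Type (u + 1) where
  obj S := Quotient (hX.isoClassSetoid S.unop)
  -- Restriction is precomposition on formal pullbacks, so it is strictly functorial with no choice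
  -- of pullbacks.
  map {S T} f := TypeCat.ofHom (Quotient.map (fun s => ⟨s.1, f.unop ≫ s.2⟩)
    (fun _ _ ⟨z, a, b, e, ha, hb⟩ => ⟨z, a, b, f.unop ≫ e, by simp [ha], by simp [hb]⟩))
  map_id S := by
    ext s
    induction s using Quotient.inductionOn with | _ s
    simp [Quotient.map_mk]
  map_comp f g := by
    ext s
    induction s using Quotient.inductionOn with | _ s
    simp [Quotient.map_mk]

/-- The isomorphism class of the pullback of `x` along `h`. -/
def isoClass {S : C} (x : X.obj) (h : S ⟶ X.p.obj x) : hX.isoClasses.obj (op S) :=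
  Quotient.mk (hX.isoClassSetoid S) ⟨x, h⟩

theorem isoClasses_map_isoClass {S T : C} (x : X.obj) (h : S ⟶ X.p.obj x) (f : T ⟶ S) :
    hX.isoClasses.map f.op (hX.isoClass x h) = hX.isoClass x (f ≫ h) := rfl

theorem isoClass_comp_map {S : C} {x y : X.obj} (h : S ⟶ X.p.obj x) (a : x ⟶ y) :
    hX.isoClass y (h ≫ X.p.map a) = hX.isoClass x h :=
  Quotient.sound ⟨x, a, 𝟙 _, h, rfl, by simp⟩

/-- Translates between classes and arrows: the left leg of a span witnessing the equality is split
by factoring `𝟙 x` through it. -/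
theorem isoClass_id_eq_iff {x y : X.obj} (g : X.p.obj x ⟶ X.p.obj y) :
    hX.isoClass x (𝟙 _) = hX.isoClass y g ↔ ∃ a : x ⟶ y, X.p.map a = g := by
  constructor
  · intro h
    obtain ⟨z, a, b, e, ha, hb⟩ := Quotient.exact h
    refine ⟨hX.factor a (𝟙 x) e (by simpa using ha) ≫ b, ?_⟩
    rw [X.p.map_comp, hX.map_factor, hb]
  · rintro ⟨a, rfl⟩
    simpa using (hX.isoClass_comp_map (𝟙 _) a).symm

theorem exists_isoClass_eq {S : C} (s : hX.isoClasses.obj (op S)) :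
    ∃ (x : X.obj) (e : X.p.obj x = S), s = hX.isoClass x (eqToHom e.symm) := by
  obtain ⟨⟨y, h⟩, rfl⟩ := Quotient.exists_rep s
  change S ⟶ X.p.obj y at h
  obtain ⟨x, rfl, a, ha⟩ := hX.exists_lift y h
  obtain rfl : X.p.map a = h := by simpa using ha
  refine ⟨x, rfl, ?_⟩
  change hX.isoClass y (X.p.map a) = _
  simpa using hX.isoClass_comp_map (𝟙 _) a

end IsFiberedInGroupoids

/-- Representatives and comparison arrows are chosen arbitrarily; thinness makes the choices
functorial, hence an effective descent datum, which gives existence. For uniqueness, local arrows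
between two representatives are compatible by thinness and glue. -/
theorem IsStack.isSheaf_isoClasses {J : GrothendieckTopology C} (hX : IsStack J X)
    (hthin : HasThinFibers X) : Presieve.IsSheaf J hX.isFiberedInGroupoids.isoClasses := by
  have hXg := hX.isFiberedInGroupoids
  intro S R hR t ht
  refine existsUnique_of_exists_of_unique ?_ ?_
  · choose ξ hξ htξ using fun r : R.arrows.category => hXg.exists_isoClass_eq (t r.obj.hom r.property)
    have hmap : ∀ {r r' : R.arrows.category} (k : r ⟶ r'), ∃ a : ξ r ⟶ ξ r',
        X.p.map a = eqToHom (hξ r) ≫ k.hom.left ≫ eqToHom (hξ r').symm := by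
      intro r r' k
      rw [← hXg.isoClass_id_eq_iff]
      have hk := ht k.hom.left (𝟙 _) r'.property r.property (by simp)
      rw [htξ, htξ, hXg.isoClasses_map_isoClass, hXg.isoClasses_map_isoClass] at hk
      have hk' := congrArg (hXg.isoClasses.map (eqToHom (hξ r)).op) hk.symm
      rw [hXg.isoClasses_map_isoClass, hXg.isoClasses_map_isoClass] at hk'
      simpa using hk'
    choose m hm using @hmap
    let D : DescentDatum X R :=
      { obj := ξ
        map := m
        map_id := fun r => hthin _ _ (by simp [hm])
        map_comp := fun k l => hthin _ _ (by simp [hm])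
        w := CategoryTheory.Functor.ext hξ (fun r r' k => hm k) }
    obtain ⟨x, rfl, a, ha, -⟩ := hX.effective S R hR D
    refine ⟨hXg.isoClass x (𝟙 _), fun T f hf => ?_⟩
    let r : R.arrows.category := Presieve.categoryMk R.arrows f hf
    rw [hXg.isoClasses_map_isoClass]
    refine Eq.trans ?_ (htξ r).symm
    have hpa : eqToHom (hξ r).symm ≫ X.p.map (a r) = f := by
      have := (isHomLift_iff_map_comp_eqToHom (hξ r) rfl _ _).1 (ha r)
      rw [eqToHom_refl, Category.comp_id] at this
      rw [this]
      simp [r]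
    rw [← hXg.isoClass_comp_map _ (a r), hpa, Category.comp_id]
  · intro s s' hs hs'
    obtain ⟨x, rfl, rfl⟩ := hXg.exists_isoClass_eq s
    obtain ⟨y, e, rfl⟩ := hXg.exists_isoClass_eq s'
    have key : ∀ (x' : X.obj) (a : x' ⟶ x), R (X.p.map a) →
        ∃ b : x' ⟶ y, X.p.map b = X.p.map a ≫ eqToHom e.symm := by
      intro x' a ha
      rw [← hXg.isoClass_id_eq_iff]
      have := (hs _ ha).trans (hs' _ ha).symm
      rw [hXg.isoClasses_map_isoClass, hXg.isoClasses_map_isoClass] at this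
      rw [← this, ← hXg.isoClass_comp_map _ a]
      simp
    choose ψ hψ using key
    obtain ⟨φ, ⟨hφ, -⟩, -⟩ := hX.existsUnique_glue_of_base _ hR ψ hψ
      (fun x' x'' c a ha hca => hthin _ _ (by simp [hψ]))
    rw [← hφ, eqToHom_refl, hXg.isoClass_id_eq_iff]
    exact ⟨φ, rfl⟩

/-- The morphism from a category fibered in groupoids to its isomorphism classes. -/
def IsFiberedInGroupoids.toIsoClasses (hX : IsFiberedInGroupoids X) :
    BasedFunctor X (ofPresheaf hX.isoClasses) where
  obj x := op ⟨op (X.p.obj x), hX.isoClass x (𝟙 _)⟩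
  map {x y} a := Quiver.Hom.op ⟨(X.p.map a).op, by
    change hX.isoClasses.map (X.p.map a).op (hX.isoClass y (𝟙 _)) = hX.isoClass x (𝟙 _)
    rw [hX.isoClasses_map_isoClass, Category.comp_id, ← hX.isoClass_comp_map _ a,
      Category.id_comp]⟩
  map_id x := Quiver.Hom.unop_inj (Subtype.ext (congrArg Quiver.Hom.op (X.p.map_id x)))
  map_comp a b := Quiver.Hom.unop_inj (Subtype.ext (congrArg Quiver.Hom.op (X.p.map_comp a b)))
  w := rfl

theorem ofPresheaf_hom_ext {F : Cᵒᵖ ⥤ Type (u + 1)} : HasThinFibers (ofPresheaf F) := by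
  intro s t u v h
  exact Quiver.Hom.unop_inj (Subtype.ext (congrArg Quiver.Hom.op h))

theorem IsFiberedInGroupoids.isIsomorphism_toIsoClasses (hX : IsFiberedInGroupoids X)
    (hthin : HasThinFibers X) : IsIsomorphism hX.toIsoClasses := by
  intro S
  refine { faithful := ⟨fun {x y} φ ψ _ => ?_⟩, full := ⟨fun {x y} ψ => ?_⟩,
           essSurj := ⟨fun s => ?_⟩ }
  · have h1 := φ.2
    have h2 := ψ.2
    exact Subtype.ext (hthin _ _ ((IsHomLift.fac' X.p (𝟙 S) φ.1).trans
      (IsHomLift.fac' X.p (𝟙 S) ψ.1).symm))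
  · have hψ : hX.isoClass x.1 (𝟙 _) =
        hX.isoClass y.1 ((ofPresheaf hX.isoClasses).p.map ψ.1) := by
      refine (ψ.1.unop.2).symm.trans ?_
      exact congrArg (hX.isoClass y.1) (Category.comp_id _)
    obtain ⟨a, ha⟩ := (hX.isoClass_id_eq_iff _).1 hψ
    have hlift : X.p.IsHomLift (𝟙 S) a := by
      have := (isHomLift_iff_map_comp_eqToHom (X := ofPresheaf hX.isoClasses)
        (x := hX.toIsoClasses.obj x.1) (y := hX.toIsoClasses.obj y.1) x.2 y.2 _ ψ.1).1 ψ.2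
      rw [isHomLift_iff_map_comp_eqToHom x.2 y.2, ha]
      exact this
    exact ⟨⟨a, hlift⟩, Subtype.ext (ofPresheaf_hom_ext _ _ ha)⟩
  · obtain ⟨⟨⟨T⟩, s⟩, hs⟩ := s
    change T = S at hs
    subst hs
    obtain ⟨x, rfl, rfl⟩ := hX.exists_isoClass_eq s
    exact ⟨⟨x, rfl⟩, ⟨Iso.refl _⟩⟩

theorem IsStack.isSpace {J : GrothendieckTopology C} (hX : IsStack J X)
    (hthin : HasThinFibers X) : IsSpace J X where
  isStack := hX
  exists_sheaf := ⟨_, hX.isSheaf_isoClasses hthin, _,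
    hX.isFiberedInGroupoids.isIsomorphism_toIsoClasses hthin⟩

/-- A vertical endomorphism becomes an identity in a category fibered in sets, and the equivalence
is faithful on fibers. -/
theorem IsSpace.hasThinFibers {J : GrothendieckTopology C} (hX : IsSpace J X) :
    HasThinFibers X := by
  obtain ⟨⟨hXg, -, -⟩, F, -, e, he⟩ := hX
  rw [hasThinFibers_iff_isFiberwiseFaithful_toTerminal]
  refine hXg.isFiberwiseFaithful_of_endomorphisms terminalBased_isFiberedInGroupoids _
    fun x w hw _ => ?_
  have := (he (X.p.obj x)).faithful
  let x₀ : X.p.Fiber (X.p.obj x) := ⟨x, rfl⟩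
  let w₀ : x₀ ⟶ x₀ := ⟨w, (isHomLift_iff_map_eq _ _).2 hw⟩
  have : w₀ = 𝟙 x₀ := by
    apply (fiberMap e (X.p.obj x)).map_injective
    refine Subtype.ext (ofPresheaf_hom_ext _ _ ?_)
    change (ofPresheaf F).p.map (e.map w) = (ofPresheaf F).p.map (e.map (𝟙 x))
    rw [map_map_eq, map_map_eq, hw, X.p.map_id]
  exact congrArg Subtype.val this

/-! ### Fiber products of stacks are stacks -/

theorem map_eq_map_of_isHomLift {S T : C} (k : S ⟶ T) {x y : X.obj} {c c' : x ⟶ y}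
    (hc : X.p.IsHomLift k c) (hc' : X.p.IsHomLift k c') : X.p.map c = X.p.map c' :=
  (IsHomLift.fac' X.p k c).trans (IsHomLift.fac' X.p k c').symm

namespace IsFiberedInGroupoids

variable (hX : IsFiberedInGroupoids X)
include hX

theorem exists_isHomLift {x : X.obj} {S T : C} (hx : X.p.obj x = S) (h : T ⟶ S) :
    ∃ (x' : X.obj) (a : x' ⟶ x), X.p.IsHomLift h a := by
  subst hx
  obtain ⟨x', rfl, a, ha⟩ := hX.exists_lift x h
  exact ⟨x', a, (isHomLift_iff_map_eq _ _).2 (by simpa using ha)⟩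

theorem exists_factor_isHomLift {S T U : C} {h : S ⟶ T} {k : U ⟶ S} {x' x z : X.obj}
    (a : x' ⟶ x) (ha : X.p.IsHomLift h a) (b : z ⟶ x) (hb : X.p.IsHomLift (k ≫ h) b) :
    ∃ c : z ⟶ x', X.p.IsHomLift k c ∧ c ≫ a = b := by
  have hz := IsHomLift.domain_eq X.p (k ≫ h) b
  subst hz
  cases ha
  have w : k ≫ X.p.map a = X.p.map b := IsHomLift.eq_of_isHomLift X.p _ b
  exact ⟨hX.factor a b k w, (isHomLift_iff_map_eq _ _).2 (hX.map_factor a b k w),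
    hX.factor_comp a b k w⟩

end IsFiberedInGroupoids

section FiberProduct

variable {f : BasedFunctor X Z} {g : BasedFunctor Y Z}

namespace FiberProductObj

variable (P : FiberProductObj f g)

/-- The pulled-back isomorphism is the vertical factor of `f(a) ≫ α` through the cartesian arrow
`g(b)`. -/
theorem exists_iso_pull (hZ : IsFiberedInGroupoids Z) {T : C} (h : T ⟶ P.base) {x' : X.obj}
    {y' : Y.obj} (a : x' ⟶ P.left) (b : y' ⟶ P.right) (ha : X.p.IsHomLift h a)
    (hb : Y.p.IsHomLift h b) : ∃ e : f.obj x' ≅ g.obj y', Z.p.IsHomLift (𝟙 T) e.hom ∧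
      f.map a ≫ P.iso.hom = e.hom ≫ g.map b := by
  have := P.iso_lift
  obtain ⟨c, hc, hcb⟩ := hZ.exists_factor_isHomLift (k := 𝟙 T) (h := h) (g.map b) inferInstance
    (f.map a ≫ P.iso.hom) inferInstance
  have := hZ.isIso_of_map_eq_id c hc
  exact ⟨asIso c, hc, hcb.symm⟩

/-- The pullback of an object of a fiber product, with prescribed pullbacks of its components. -/
noncomputable def pull (hZ : IsFiberedInGroupoids Z) {T : C} (h : T ⟶ P.base) {x' : X.obj}
    {y' : Y.obj} (a : x' ⟶ P.left) (b : y' ⟶ P.right) (ha : X.p.IsHomLift h a)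
    (hb : Y.p.IsHomLift h b) : FiberProductObj f g where
  base := T
  left := x'
  right := y'
  left_over := IsHomLift.domain_eq X.p h a
  right_over := IsHomLift.domain_eq Y.p h b
  iso := (P.exists_iso_pull hZ h a b ha hb).choose
  iso_lift := (P.exists_iso_pull hZ h a b ha hb).choose_spec.1

/-- The arrow from a pullback of an object of a fiber product. -/
noncomputable def pullHom (hZ : IsFiberedInGroupoids Z) {T : C} (h : T ⟶ P.base) {x' : X.obj}
    {y' : Y.obj} (a : x' ⟶ P.left) (b : y' ⟶ P.right) (ha : X.p.IsHomLift h a)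
    (hb : Y.p.IsHomLift h b) : P.pull hZ h a b ha hb ⟶ P where
  base := h
  left := a
  right := b
  left_lift := ha
  right_lift := hb
  comm := (P.exists_iso_pull hZ h a b ha hb).choose_spec.2

end FiberProductObj

namespace FiberProductHom

variable {P Q Q' : FiberProductObj f g}

theorem comp_left (m : P ⟶ Q) (n : Q ⟶ Q') : (m ≫ n).left = m.left ≫ n.left := rfl
theorem comp_right (m : P ⟶ Q) (n : Q ⟶ Q') : (m ≫ n).right = m.right ≫ n.right := rfl

/-- The components factor separately; their compatibility in `Z` may be tested after composing with
the cartesian arrow `g(m.right)`. -/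
theorem exists_factor (hX : IsFiberedInGroupoids X) (hY : IsFiberedInGroupoids Y)
    (hZ : IsFiberedInGroupoids Z) (m : Q ⟶ P) (n : Q' ⟶ P) (k : Q'.base ⟶ Q.base)
    (w : k ≫ m.base = n.base) : ∃ c : Q' ⟶ Q, c.base = k ∧ c ≫ m = n := by
  have := m.left_lift
  have := m.right_lift
  have := Q.iso_lift
  have := Q'.iso_lift
  obtain ⟨l, hl, hlm⟩ := hX.exists_factor_isHomLift (k := k) m.left m.left_lift n.left
    (w ▸ n.left_lift)
  obtain ⟨r, hr, hrm⟩ := hY.exists_factor_isHomLift (k := k) m.right m.right_lift n.right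
    (w ▸ n.right_lift)
  refine ⟨⟨k, l, r, hl, hr, hZ.hom_ext (g.map m.right)
    (map_eq_map_of_isHomLift k inferInstance inferInstance) ?_⟩, rfl,
    FiberProductHom.ext w hlm hrm⟩
  rw [Category.assoc, ← m.comm, ← Category.assoc, ← f.map_comp, hlm, n.comm, Category.assoc,
    ← g.map_comp, hrm]

theorem ext_of_comp_eq (hX : IsFiberedInGroupoids X) (hY : IsFiberedInGroupoids Y) (m : Q ⟶ P)
    {c c' : Q' ⟶ Q} (hb : c.base = c'.base) (h : c ≫ m = c' ≫ m) : c = c' :=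
  FiberProductHom.ext hb
    (hX.hom_ext m.left (map_eq_map_of_isHomLift c.base c.left_lift (hb ▸ c'.left_lift))
      (congrArg FiberProductHom.left h))
    (hY.hom_ext m.right (map_eq_map_of_isHomLift c.base c.right_lift (hb ▸ c'.right_lift))
      (congrArg FiberProductHom.right h))

/-- The left component already determines the base arrow, and the right component then comes from
cartesianness. -/
theorem exists_factor_of_left (hX : IsFiberedInGroupoids X) (hY : IsFiberedInGroupoids Y)
    (hZ : IsFiberedInGroupoids Z) (m : Q ⟶ P) (n : Q' ⟶ P) (l : Q'.left ⟶ Q.left)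
    (hl : l ≫ m.left = n.left) : ∃ c : Q' ⟶ Q, c.left = l ∧ c ≫ m = n := by
  let k : Q'.base ⟶ Q.base := eqToHom Q'.left_over.symm ≫ X.p.map l ≫ eqToHom Q.left_over
  have hk : X.p.IsHomLift k l := inferInstance
  have := m.left_lift
  have := n.left_lift
  have w : k ≫ m.base = n.base := by
    have h1 : X.p.IsHomLift (k ≫ m.base) n.left := hl ▸ inferInstance
    rw [IsHomLift.fac X.p (k ≫ m.base) n.left, IsHomLift.fac X.p n.base n.left]
  obtain ⟨c, hc, hcm⟩ := exists_factor hX hY hZ m n k w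
  refine ⟨c, hX.hom_ext m.left (map_eq_map_of_isHomLift k (hc ▸ c.left_lift) hk) ?_, hcm⟩
  rw [hl, ← hcm, comp_left]

theorem exists_factor_of_right (hX : IsFiberedInGroupoids X) (hY : IsFiberedInGroupoids Y)
    (hZ : IsFiberedInGroupoids Z) (m : Q ⟶ P) (n : Q' ⟶ P) (r : Q'.right ⟶ Q.right)
    (hr : r ≫ m.right = n.right) : ∃ c : Q' ⟶ Q, c.right = r ∧ c ≫ m = n := by
  let k : Q'.base ⟶ Q.base := eqToHom Q'.right_over.symm ≫ Y.p.map r ≫ eqToHom Q.right_over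
  have hk : Y.p.IsHomLift k r := inferInstance
  have := m.right_lift
  have := n.right_lift
  have w : k ≫ m.base = n.base := by
    have h1 : Y.p.IsHomLift (k ≫ m.base) n.right := hr ▸ inferInstance
    rw [IsHomLift.fac Y.p (k ≫ m.base) n.right, IsHomLift.fac Y.p n.base n.right]
  obtain ⟨c, hc, hcm⟩ := exists_factor hX hY hZ m n k w
  refine ⟨c, hY.hom_ext m.right (map_eq_map_of_isHomLift k (hc ▸ c.right_lift) hk) ?_, hcm⟩
  rw [hr, ← hcm, comp_right]

theorem map_left (m : P ⟶ Q) : X.p.map m.left =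
    eqToHom P.left_over ≫ m.base ≫ eqToHom Q.left_over.symm :=
  have := m.left_lift
  IsHomLift.fac' X.p m.base m.left

theorem map_right (m : P ⟶ Q) : Y.p.map m.right =
    eqToHom P.right_over ≫ m.base ≫ eqToHom Q.right_over.symm :=
  have := m.right_lift
  IsHomLift.fac' Y.p m.base m.right

end FiberProductHom

theorem isFiberedInGroupoids_fiberProduct (hX : IsFiberedInGroupoids X)
    (hY : IsFiberedInGroupoids Y) (hZ : IsFiberedInGroupoids Z) :
    IsFiberedInGroupoids (fiberProduct f g) := by
  refine isFiberedInGroupoids_of_exists_lift_of_existsUnique_factor (fun P T h => ?_)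
    (fun Q P Q' m n k w => ?_)
  · change FiberProductObj f g at P
    obtain ⟨x', a, ha⟩ := hX.exists_isHomLift P.left_over h
    obtain ⟨y', b, hb⟩ := hY.exists_isHomLift P.right_over h
    exact ⟨P.pull hZ h a b ha hb, rfl, P.pullHom hZ h a b ha hb, (Category.id_comp h).symm⟩
  · obtain ⟨c, hc, hcm⟩ := FiberProductHom.exists_factor hX hY hZ m n k w
    exact ⟨c, ⟨hc, hcm⟩, fun c' ⟨hc', hcm'⟩ =>
      FiberProductHom.ext_of_comp_eq hX hY m (hc'.trans hc.symm) (hcm'.trans hcm.symm)⟩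

/-- The first projection of a fiber product. -/
def fiberProductFst (f : BasedFunctor X Z) (g : BasedFunctor Y Z) :
    BasedFunctor (fiberProduct f g) X where
  obj P := P.left
  map m := FiberProductHom.left m
  map_id _ := rfl
  map_comp _ _ := rfl
  w := CategoryTheory.Functor.ext (fun P => P.left_over) (fun _ _ m => FiberProductHom.map_left m)

/-- The second projection of a fiber product. -/
def fiberProductSnd (f : BasedFunctor X Z) (g : BasedFunctor Y Z) :
    BasedFunctor (fiberProduct f g) Y where
  obj P := P.right
  map m := FiberProductHom.right m
  map_id _ := rfl
  map_comp _ _ := rfl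
  w := CategoryTheory.Functor.ext (fun P => P.right_over)
    (fun _ _ m => FiberProductHom.map_right m)

end FiberProduct

section

variable {f : BasedFunctor X Z} {g : BasedFunctor Y Z} {J : GrothendieckTopology C}

namespace FiberProductObj

variable (P : FiberProductObj f g)

/-- Lets local statements about the component `P.left` in `X` be tested on arrows to `P` in the
fiber product. -/
theorem exists_hom_of_left (hY : IsFiberedInGroupoids Y) (hZ : IsFiberedInGroupoids Z)
    {x' : X.obj} (a : x' ⟶ P.left) :
    ∃ (P' : FiberProductObj f g) (m : P' ⟶ P) (e : P'.left = x'), m.left = eqToHom e ≫ a :=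
  have ⟨_, b, hb⟩ := hY.exists_isHomLift P.right_over (X.p.map a ≫ eqToHom P.left_over)
  ⟨_, P.pullHom hZ _ a b inferInstance hb, rfl,
    by exact (Category.id_comp a).symm⟩

theorem exists_hom_of_right (hX : IsFiberedInGroupoids X) (hZ : IsFiberedInGroupoids Z)
    {y' : Y.obj} (b : y' ⟶ P.right) :
    ∃ (P' : FiberProductObj f g) (m : P' ⟶ P) (e : P'.right = y'), m.right = eqToHom e ≫ b :=
  have ⟨_, a, ha⟩ := hX.exists_isHomLift P.left_over (Y.p.map b ≫ eqToHom P.right_over)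
  ⟨_, P.pullHom hZ _ a b ha inferInstance, rfl, (Category.id_comp b).symm⟩

end FiberProductObj

theorem sieveOver_left_iff {P P' : FiberProductObj f g} {R : Sieve P.base} (m : P' ⟶ P) :
    sieveOver P.left_over R m.left ↔ R m.base := by
  change R (X.p.map m.left ≫ eqToHom P.left_over) ↔ _
  rw [FiberProductHom.map_left, Category.assoc, Category.assoc, eqToHom_trans, eqToHom_refl,
    Category.comp_id]
  exact ⟨fun h => by simpa using R.downward_closed h (eqToHom P'.left_over.symm),
    fun h => R.downward_closed h _⟩

theorem sieveOver_right_iff {P P' : FiberProductObj f g} {R : Sieve P.base} (m : P' ⟶ P) :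
    sieveOver P.right_over R m.right ↔ R m.base := by
  change R (Y.p.map m.right ≫ eqToHom P.right_over) ↔ _
  rw [FiberProductHom.map_right, Category.assoc, Category.assoc, eqToHom_trans, eqToHom_refl,
    Category.comp_id]
  exact ⟨fun h => by simpa using R.downward_closed h (eqToHom P'.right_over.symm),
    fun h => R.downward_closed h _⟩

theorem fiberProduct_hom_ext (hX : IsStack J X) (hY : IsStack J Y)
    (hZ : IsFiberedInGroupoids Z) {P Q : FiberProductObj f g} {φ φ' : P ⟶ Q}
    (hb : φ.base = φ'.base) {R : Sieve P.base} (hR : R ∈ J P.base)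
    (h : ∀ (P' : FiberProductObj f g) (m : P' ⟶ P), R m.base → m ≫ φ = m ≫ φ') : φ = φ' := by
  refine FiberProductHom.ext hb ?_ ?_
  · refine hX.hom_ext_of_mem (map_eq_map_of_isHomLift φ.base φ.left_lift (hb ▸ φ'.left_lift))
      (sieveOver_mem _ P.left_over hR) fun x' a ha => ?_
    obtain ⟨P', m, rfl, hm⟩ := P.exists_hom_of_left hY.isFiberedInGroupoids hZ a
    obtain rfl : m.left = a := by simpa using hm
    exact congrArg FiberProductHom.left (h P' m ((sieveOver_left_iff m).1 ha))
  · refine hY.hom_ext_of_mem (map_eq_map_of_isHomLift φ.base φ.right_lift (hb ▸ φ'.right_lift))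
      (sieveOver_mem _ P.right_over hR) fun y' b hb' => ?_
    obtain ⟨P', m, rfl, hm⟩ := P.exists_hom_of_right hX.isFiberedInGroupoids hZ b
    obtain rfl : m.right = b := by simpa using hm
    exact congrArg FiberProductHom.right (h P' m ((sieveOver_right_iff m).1 hb'))

section Glue

variable {P Q : FiberProductObj f g} (k : P.base ⟶ Q.base) {R : Sieve P.base}
  (ψ : ∀ (P' : FiberProductObj f g) (m : P' ⟶ P), R m.base → (P' ⟶ Q))

theorem exists_glue_left (hX : IsStack J X) (hY : IsFiberedInGroupoids Y)
    (hZ : IsFiberedInGroupoids Z) (hR : R ∈ J P.base)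
    (hψ : ∀ (P' : FiberProductObj f g) (m : P' ⟶ P) (hm : R m.base),
      (ψ P' m hm).base = m.base ≫ k)
    (hcomp : ∀ (P' P'' : FiberProductObj f g) (c : P'' ⟶ P') (m : P' ⟶ P) (hm : R m.base)
      (hcm : R (c ≫ m).base), ψ P'' (c ≫ m) hcm = c ≫ ψ P' m hm) :
    ∃ φ : P.left ⟶ Q.left, X.p.IsHomLift k φ ∧
      ∀ (P' : FiberProductObj f g) (m : P' ⟶ P) (hm : R m.base),
        m.left ≫ φ = (ψ P' m hm).left := by
  have hXg := hX.isFiberedInGroupoids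
  -- The value on `a` is the left component of `ψ` at some extension of `a` to an arrow into `P`.
  -- The property stated makes it independent of that extension and compatible with restriction.
  have key : ∀ (x' : X.obj) (a : x' ⟶ P.left), sieveOver P.left_over R a →
      ∃ v : x' ⟶ Q.left, ∀ (P' : FiberProductObj f g) (m : P' ⟶ P) (hm : R m.base)
        (c : P'.left ⟶ x'), c ≫ a = m.left → c ≫ v = (ψ P' m hm).left := by
    intro x' a ha
    obtain ⟨P₀, n, rfl, hn⟩ := P.exists_hom_of_left hY hZ a
    obtain rfl : n.left = a := by simpa using hn
    have hn' := (sieveOver_left_iff n).1 ha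
    refine ⟨(ψ _ n hn').left, fun P' m hm c hc => ?_⟩
    obtain ⟨d, rfl, rfl⟩ := FiberProductHom.exists_factor_of_left hXg hY hZ n m c hc
    rw [hcomp _ _ d n hn' hm]
    rfl
  choose v hv using key
  obtain ⟨φ, hφ, hφv⟩ := hX.exists_glue
    (eqToHom P.left_over ≫ k ≫ eqToHom Q.left_over.symm) (sieveOver_mem hXg P.left_over hR) v
    (fun x' a ha => by
      obtain ⟨P', m, rfl, hm⟩ := P.exists_hom_of_left hY hZ a
      obtain rfl : m.left = a := by simpa using hm
      have h := hv _ _ ha P' m ((sieveOver_left_iff m).1 ha) (𝟙 _) (Category.id_comp _)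
      rw [Category.id_comp] at h
      rw [h]
      simp [FiberProductHom.map_left, hψ])
    (fun x' x'' c a ha hca => by
      obtain ⟨P', m, rfl, hm⟩ := P.exists_hom_of_left hY hZ (c ≫ a)
      have hm' : m.left = c ≫ a := by simpa using hm
      have hm'' : R m.base := (sieveOver_left_iff m).1 (hm' ▸ hca)
      have h := hv _ _ hca P' m hm'' (𝟙 _) ((Category.id_comp _).trans hm'.symm)
      rw [Category.id_comp] at h
      rw [h, hv _ _ ha P' m hm'' c hm'.symm])
  refine ⟨φ, IsHomLift.of_fac' X.p k φ P.left_over Q.left_over hφ, fun P' m hm => ?_⟩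
  have hm' := (sieveOver_left_iff m).2 hm
  rw [hφv _ _ hm', ← hv _ _ hm' P' m hm (𝟙 _) (Category.id_comp _), Category.id_comp]

theorem exists_glue_right (hX : IsFiberedInGroupoids X) (hY : IsStack J Y)
    (hZ : IsFiberedInGroupoids Z) (hR : R ∈ J P.base)
    (hψ : ∀ (P' : FiberProductObj f g) (m : P' ⟶ P) (hm : R m.base),
      (ψ P' m hm).base = m.base ≫ k)
    (hcomp : ∀ (P' P'' : FiberProductObj f g) (c : P'' ⟶ P') (m : P' ⟶ P) (hm : R m.base)
      (hcm : R (c ≫ m).base), ψ P'' (c ≫ m) hcm = c ≫ ψ P' m hm) :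
    ∃ φ : P.right ⟶ Q.right, Y.p.IsHomLift k φ ∧
      ∀ (P' : FiberProductObj f g) (m : P' ⟶ P) (hm : R m.base),
        m.right ≫ φ = (ψ P' m hm).right := by
  have hYg := hY.isFiberedInGroupoids
  have key : ∀ (x' : Y.obj) (a : x' ⟶ P.right), sieveOver P.right_over R a →
      ∃ v : x' ⟶ Q.right, ∀ (P' : FiberProductObj f g) (m : P' ⟶ P) (hm : R m.base)
        (c : P'.right ⟶ x'), c ≫ a = m.right → c ≫ v = (ψ P' m hm).right := by
    intro x' a ha
    obtain ⟨P₀, n, rfl, hn⟩ := P.exists_hom_of_right hX hZ a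
    obtain rfl : n.right = a := by simpa using hn
    have hn' := (sieveOver_right_iff n).1 ha
    refine ⟨(ψ _ n hn').right, fun P' m hm c hc => ?_⟩
    obtain ⟨d, rfl, rfl⟩ := FiberProductHom.exists_factor_of_right hX hYg hZ n m c hc
    rw [hcomp _ _ d n hn' hm]
    rfl
  choose v hv using key
  obtain ⟨φ, hφ, hφv⟩ := hY.exists_glue
    (eqToHom P.right_over ≫ k ≫ eqToHom Q.right_over.symm) (sieveOver_mem hYg P.right_over hR) v
    (fun x' a ha => by
      obtain ⟨P', m, rfl, hm⟩ := P.exists_hom_of_right hX hZ a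
      obtain rfl : m.right = a := by simpa using hm
      have h := hv _ _ ha P' m ((sieveOver_right_iff m).1 ha) (𝟙 _) (Category.id_comp _)
      rw [Category.id_comp] at h
      rw [h]
      simp [FiberProductHom.map_right, hψ])
    (fun x' x'' c a ha hca => by
      obtain ⟨P', m, rfl, hm⟩ := P.exists_hom_of_right hX hZ (c ≫ a)
      have hm' : m.right = c ≫ a := by simpa using hm
      have hm'' : R m.base := (sieveOver_right_iff m).1 (hm' ▸ hca)
      have h := hv _ _ hca P' m hm'' (𝟙 _) ((Category.id_comp _).trans hm'.symm)
      rw [Category.id_comp] at h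
      rw [h, hv _ _ ha P' m hm'' c hm'.symm])
  refine ⟨φ, IsHomLift.of_fac' Y.p k φ P.right_over Q.right_over hφ, fun P' m hm => ?_⟩
  have hm' := (sieveOver_right_iff m).2 hm
  rw [hφv _ _ hm', ← hv _ _ hm' P' m hm (𝟙 _) (Category.id_comp _), Category.id_comp]

theorem exists_glue_fiberProduct (hX : IsStack J X) (hY : IsStack J Y) (hZ : IsStack J Z)
    (hR : R ∈ J P.base)
    (hψ : ∀ (P' : FiberProductObj f g) (m : P' ⟶ P) (hm : R m.base),
      (ψ P' m hm).base = m.base ≫ k)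
    (hcomp : ∀ (P' P'' : FiberProductObj f g) (c : P'' ⟶ P') (m : P' ⟶ P) (hm : R m.base)
      (hcm : R (c ≫ m).base), ψ P'' (c ≫ m) hcm = c ≫ ψ P' m hm) :
    ∃ φ : P ⟶ Q, φ.base = k ∧ ∀ (P' : FiberProductObj f g) (m : P' ⟶ P) (hm : R m.base),
      m ≫ φ = ψ P' m hm := by
  have hXg := hX.isFiberedInGroupoids
  have hYg := hY.isFiberedInGroupoids
  have hZg := hZ.isFiberedInGroupoids
  obtain ⟨l, hl, hlψ⟩ := exists_glue_left k ψ hX hYg hZg hR hψ hcomp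
  obtain ⟨r, hr, hrψ⟩ := exists_glue_right k ψ hXg hY hZg hR hψ hcomp
  have := P.iso_lift
  have := Q.iso_lift
  refine ⟨⟨k, l, r, hl, hr, ?_⟩, rfl, fun P' m hm => FiberProductHom.ext (hψ P' m hm).symm
    (hlψ P' m hm) (hrψ P' m hm)⟩
  -- The compatibility square in `Z` is checked on the covering sieve generated by the images of
  -- arrows over `R`, where it is the square of `ψ`.
  refine hZ.hom_ext_of_mem (map_eq_map_of_isHomLift k inferInstance inferInstance)
    (functorPushforward_mem hXg hZg f (sieveOver_mem hXg P.left_over hR)) ?_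
  rintro z d ⟨x', a, c, ha, rfl⟩
  obtain ⟨P', m, rfl, hm⟩ := P.exists_hom_of_left hYg hZg a
  obtain rfl : m.left = a := by simpa using hm
  have hm' : R m.base := (sieveOver_left_iff m).1 ha
  have h1 : f.map m.left ≫ f.map l = f.map (ψ _ m hm').left := by
    rw [← f.map_comp, hlψ _ m hm']
  have h2 : g.map m.right ≫ g.map r = g.map (ψ _ m hm').right := by
    rw [← g.map_comp, hrψ _ m hm']
  rw [Category.assoc, Category.assoc, reassoc_of% h1, reassoc_of% m.comm, h2, (ψ _ m hm').comm]

end Glue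

theorem isomsFormSheaf_fiberProduct (hX : IsStack J X) (hY : IsStack J Y) (hZ : IsStack J Z) :
    IsomsFormSheaf J (fiberProduct f g) :=
  isomsFormSheaf_of_exists_glue
    (fun _ _ _ _ hp _ hR h => fiberProduct_hom_ext hX hY hZ.isFiberedInGroupoids hp hR h)
    (fun _ _ k _ hR ψ hψ hcomp => exists_glue_fiberProduct k ψ hX hY hZ hR hψ hcomp)

theorem effective_fiberProduct (hX : IsStack J X) (hY : IsStack J Y) (hZ : IsStack J Z)
    {S : C} {R : Sieve S} (hR : R ∈ J S) (D : DescentDatum (fiberProduct f g) R) :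
    D.IsEffective := by
  let E : R.arrows.category → FiberProductObj f g := fun r => D.obj r
  let dm : ∀ {r r' : R.arrows.category} (k : r ⟶ r'), E r ⟶ E r' := fun k => D.map k
  obtain ⟨x, hx, a, ha, hac⟩ : ∃ (x : X.obj) (_ : X.p.obj x = S) (a : ∀ r, (E r).left ⟶ x),
      (∀ r : R.arrows.category, X.p.IsHomLift r.obj.hom (a r)) ∧
      ∀ (r r' : R.arrows.category) (k : r ⟶ r'), (dm k).left ≫ a r' = a r :=
    hX.effective S R hR (D.comp (fiberProductFst f g))
  obtain ⟨y, hy, b, hb, hbc⟩ : ∃ (y : Y.obj) (_ : Y.p.obj y = S) (b : ∀ r, (E r).right ⟶ y),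
      (∀ r : R.arrows.category, Y.p.IsHomLift r.obj.hom (b r)) ∧
      ∀ (r r' : R.arrows.category) (k : r ⟶ r'), (dm k).right ≫ b r' = b r :=
    hY.effective S R hR (D.comp (fiberProductSnd f g))
  have hE : ∀ r : R.arrows.category, (E r).base = r.obj.left := fun r => D.w_obj r
  have hiso : ∀ r : R.arrows.category, Z.p.IsHomLift (𝟙 r.obj.left) (E r).iso.hom :=
    fun r => hE r ▸ (E r).iso_lift
  have hfa : ∀ r, Z.p.IsHomLift r.obj.hom (f.map (a r)) := fun r => have := ha r; inferInstance
  have hgb : ∀ r, Z.p.IsHomLift r.obj.hom ((E r).iso.hom ≫ g.map (b r)) := fun r => by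
    have := hb r
    have := hiso r
    infer_instance
  -- Both `f(x)` and, through the local isomorphisms, `g(y)` receive the descent datum `f(D.left)`;
  -- comparing them glues these isomorphisms to `φ`.
  obtain ⟨φ, hφ, hφab⟩ := hZ.exists_glue_descentDatum hR ((D.comp (fiberProductFst f g)).comp f)
    ((f.w_obj x).trans hx) ((g.w_obj y).trans hy) (fun r => f.map (a r)) hfa
    (fun r r' k => (f.map_comp _ _).symm.trans (congrArg f.map (hac r r' k)))
    (fun r => (E r).iso.hom ≫ g.map (b r)) hgb
    (fun r r' k => by
      change f.map (dm k).left ≫ (E r').iso.hom ≫ g.map (b r') = (E r).iso.hom ≫ g.map (b r)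
      rw [← Category.assoc, (dm k).comm, Category.assoc, ← g.map_comp, hbc])
  have := hZ.isFiberedInGroupoids.isIso_of_map_eq_id φ hφ
  let P : FiberProductObj f g := ⟨S, x, y, hx, hy, asIso φ, hφ⟩
  have hal : ∀ r, X.p.IsHomLift (eqToHom (hE r) ≫ r.obj.hom) (a r) :=
    fun r => have := ha r; inferInstance
  have hbl : ∀ r, Y.p.IsHomLift (eqToHom (hE r) ≫ r.obj.hom) (b r) :=
    fun r => have := hb r; inferInstance
  let m : ∀ r, E r ⟶ P := fun r => ⟨eqToHom (hE r) ≫ r.obj.hom, a r, b r, hal r, hbl r, hφab r⟩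
  refine ⟨P, rfl, m, fun r => ?_, fun r r' k => FiberProductHom.ext ?_ (hac r r' k) (hbc r r' k)⟩
  · exact (isHomLift_iff_map_comp_eqToHom (X := fiberProduct f g) (x := E r) (y := P)
      (hE r) rfl _ (m r)).2 (Category.comp_id _)
  · have h1 : (dm k).base = eqToHom (hE r) ≫ k.hom.left ≫ eqToHom (hE r').symm :=
      descentDatum_map_map D k
    change (dm k).base ≫ eqToHom (hE r') ≫ r'.obj.hom = eqToHom (hE r) ≫ r.obj.hom
    rw [h1]
    simp

theorem IsStack.fiberProduct (hX : IsStack J X) (hY : IsStack J Y) (hZ : IsStack J Z) :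
    IsStack J (fiberProduct f g) where
  isFiberedInGroupoids := isFiberedInGroupoids_fiberProduct hX.isFiberedInGroupoids
    hY.isFiberedInGroupoids hZ.isFiberedInGroupoids
  isomsFormSheaf := isomsFormSheaf_fiberProduct hX hY hZ
  effective _ _ hR D := effective_fiberProduct hX hY hZ hR D

/-- Thinness of `X` fixes the left component; the square then fixes the image under `g` of the right
one. -/
theorem hasThinFibers_fiberProduct (hX : HasThinFibers X) (hg : IsFiberwiseFaithful g) :
    HasThinFibers (FiberedStack.fiberProduct f g) := by
  intro P Q m n h
  change FiberProductObj f g at P Q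
  change P ⟶ Q at m n
  change m.base = n.base at h
  have hl : m.left = n.left :=
    hX _ _ (map_eq_map_of_isHomLift m.base m.left_lift (h ▸ n.left_lift))
  refine FiberProductHom.ext h hl
    (hg _ _ (map_eq_map_of_isHomLift m.base m.right_lift (h ▸ n.right_lift)) ?_)
  rw [← cancel_epi P.iso.hom, ← m.comm, ← n.comm, hl]

end

/-! ### Categories of elements of sheaves on a stack -/

section

variable {J : GrothendieckTopology C}

/-- An object of the total category of `Y` with an element of a presheaf over it. -/
structure ElementObj (A : Y.objᵒᵖ ⥤ Type (u + 1)) where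
  obj : Y.obj
  elt : A.obj (op obj)

/-- A morphism of the total category of `Y` compatible with the elements. -/
@[ext]
structure ElementHom {A : Y.objᵒᵖ ⥤ Type (u + 1)} (s t : ElementObj A) where
  hom : s.obj ⟶ t.obj
  w : A.map hom.op t.elt = s.elt

instance (A : Y.objᵒᵖ ⥤ Type (u + 1)) : Category (ElementObj A) where
  Hom s t := ElementHom s t
  id s := ⟨𝟙 _, by simp⟩
  comp m n := ⟨m.hom ≫ n.hom, by rw [op_comp, Functor.map_comp_apply, n.w, m.w]⟩

/-- The category of elements of a presheaf on the total category of `Y`, as a category over `C`. -/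
def elements (A : Y.objᵒᵖ ⥤ Type (u + 1)) : BasedCategory.{u, u + 1} C where
  obj := ElementObj A
  p :=
    { obj := fun s => Y.p.obj s.obj
      map := fun m => Y.p.map (ElementHom.hom m)
      map_id := fun _ => Y.p.map_id _
      map_comp := fun _ _ => Y.p.map_comp _ _ }

/-- The functor forgetting the element. -/
def elementsForget (A : Y.objᵒᵖ ⥤ Type (u + 1)) : BasedFunctor (elements A) Y where
  obj s := ElementObj.obj s
  map m := ElementHom.hom m
  map_id _ := rfl
  map_comp _ _ := rfl
  w := rfl

variable {A : Y.objᵒᵖ ⥤ Type (u + 1)}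

theorem isFiberedInGroupoids_elements (hY : IsFiberedInGroupoids Y) :
    IsFiberedInGroupoids (elements A) := by
  refine isFiberedInGroupoids_of_exists_lift_of_existsUnique_factor (fun t T h => ?_)
    (fun s t r m n k w => ?_)
  · change ElementObj A at t
    obtain ⟨y, e, a, ha⟩ := hY.exists_lift t.obj h
    exact ⟨⟨y, A.map a.op t.elt⟩, e, ⟨a, rfl⟩, ha⟩
  · change ElementObj A at s t r
    change ElementHom s t at m
    change ElementHom r t at n
    obtain ⟨c, ⟨hc, hcm⟩, hu⟩ := hY.existsUnique_factor m.hom n.hom k w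
    refine ⟨⟨c, ?_⟩, ⟨hc, ElementHom.ext hcm⟩, fun c' ⟨hc', hcm'⟩ =>
      ElementHom.ext (hu c'.hom ⟨hc', congrArg ElementHom.hom hcm'⟩)⟩
    have hm : A.map m.hom.op t.elt = s.elt := m.w
    have hn : A.map n.hom.op t.elt = r.elt := n.w
    rw [← hm, ← hn, ← Functor.map_comp_apply, ← op_comp, hcm]

/-- Arrows glue in `Y`; that the glued arrow respects elements is a local equality, settled by
separatedness of `A`. -/
theorem isomsFormSheaf_elements (hY : IsStack J Y)
    (hA : Presieve.IsSheaf (totalTopology J hY.isFiberedInGroupoids) A) :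
    IsomsFormSheaf J (elements A) := by
  have hYg := hY.isFiberedInGroupoids
  refine isomsFormSheaf_of_exists_glue (fun s t φ φ' hp R hR h => ?_)
    (fun s t k R hR ψ hψ hcomp => ?_)
  · change ElementObj A at s t
    refine ElementHom.ext (hY.hom_ext_of_mem hp (sieveOver_mem hYg rfl hR) fun y a ha => ?_)
    let s' : ElementObj A := ⟨y, A.map a.op s.elt⟩
    let m : s' ⟶ s := ⟨a, rfl⟩
    have ha' : R (Y.p.map a) := by simpa [sieveOver] using ha
    exact congrArg ElementHom.hom (h s' m ha')
  · change ElementObj A at s t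
    let s' : ∀ (y : Y.obj) (a : y ⟶ s.obj), ElementObj A := fun y a => ⟨y, A.map a.op s.elt⟩
    let m : ∀ (y : Y.obj) (a : y ⟶ s.obj), s' y a ⟶ s := fun y a => ⟨a, rfl⟩
    let d : ∀ (y y' : Y.obj) (c : y' ⟶ y) (a : y ⟶ s.obj), s' y' (c ≫ a) ⟶ s' y a :=
      fun y y' c a => ⟨c, by simp [s']⟩
    obtain ⟨φ, ⟨hφ, hφψ⟩, -⟩ := hY.existsUnique_glue_of_base k hR
      (fun y a ha => (ψ (s' y a) (m y a) ha).hom)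
      (fun y a ha => hψ (s' y a) (m y a) ha)
      (fun y y' c a ha hca => congrArg ElementHom.hom
        (hcomp (s' y a) (s' y' (c ≫ a)) (d y y' c a) (m y a) ha hca))
    refine ⟨⟨φ, ?_⟩, hφ, ?_⟩
    · refine (hA (sieveOver rfl R) (sieveOver_mem hYg rfl hR)).isSeparatedFor.ext
        fun y a ha => ?_
      have ha' : R (Y.p.map a) := by simpa [sieveOver] using ha
      rw [← Functor.map_comp_apply, ← op_comp, hφψ y a ha']
      exact (ψ (s' y a) (m y a) ha').w
    · rintro ⟨y, e⟩ ⟨a, w⟩ ha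
      change y ⟶ s.obj at a
      change A.map a.op s.elt = e at w
      subst w
      exact ElementHom.ext (hφψ y a ha)

theorem effective_elements (hY : IsStack J Y)
    (hA : Presieve.IsSheaf (totalTopology J hY.isFiberedInGroupoids) A)
    {S : C} {R : Sieve S} (hR : R ∈ J S) (D : DescentDatum (elements A) R) :
    D.IsEffective := by
  have hYg := hY.isFiberedInGroupoids
  let E : R.arrows.category → ElementObj A := fun r => D.obj r
  let dm : ∀ {r r' : R.arrows.category} (k : r ⟶ r'), E r ⟶ E r' := fun k => D.map k
  obtain ⟨y, hy, a, ha, hac⟩ := hY.effective S R hR (D.comp (elementsForget A))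
  obtain ⟨r, c, hca, hc⟩ :=
    hYg.exists_factor_descentDatum (D.comp (elementsForget A)) hy a ha hac
  change ∀ r, (E r).obj ⟶ y at a
  change ∀ y' v hv, y' ⟶ (E (r y' v hv)).obj at c
  have hc' : ∀ (y' : Y.obj) (v : y' ⟶ y) (hv : sieveOver hy R v) (r₀ : R.arrows.category)
      (d : y' ⟶ (E r₀).obj), d ≫ a r₀ = v →
        A.map d.op (E r₀).elt = A.map (c y' v hv).op (E (r y' v hv)).elt := by
    intro y' v hv r₀ d hd
    obtain ⟨k, rfl⟩ := hc y' v hv r₀ d hd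
    change A.map (c y' v hv ≫ (dm k).hom).op (E r₀).elt = _
    rw [op_comp, Functor.map_comp_apply, (dm k).w]
  -- The elements of the datum, transported along canonical factorizations, form a family on `y`; by
  -- `hc'` any other factorization gives the same value.
  let t : Presieve.FamilyOfElements A (sieveOver hy R).arrows := fun y' v hv =>
    A.map (c y' v hv).op (E (r y' v hv)).elt
  have ht : t.Compatible := by
    rw [Presieve.compatible_iff_sieveCompatible]
    intro y' y'' v e hv
    have h := hc' y'' (e ≫ v) ((sieveOver hy R).downward_closed hv e) _ (e ≫ c y' v hv)
      (by rw [Category.assoc]; exact congrArg (e ≫ ·) (hca y' v hv))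
    rw [op_comp, Functor.map_comp_apply] at h
    exact h.symm
  obtain ⟨s, hs, -⟩ := hA (sieveOver hy R) (sieveOver_mem hYg hy hR) t ht
  have hsa : ∀ r₀, A.map (a r₀).op s = (E r₀).elt := by
    intro r₀
    have hv : sieveOver hy R (a r₀) := by
      have h : Y.p.map (a r₀) ≫ eqToHom hy =
          eqToHom (descentDatum_obj_over (D.comp (elementsForget A)) r₀) ≫ r₀.obj.hom :=
        (isHomLift_iff_map_comp_eqToHom _ hy _ _).1 (ha r₀)
      change R (Y.p.map (a r₀) ≫ eqToHom hy)
      rw [h]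
      exact R.downward_closed r₀.property _
    rw [hs _ hv]
    refine (hc' _ (a r₀) hv r₀ (𝟙 _) (Category.id_comp _)).symm.trans ?_
    simp
  let m : ∀ r₀, E r₀ ⟶ (⟨y, s⟩ : ElementObj A) := fun r₀ => ⟨a r₀, hsa r₀⟩
  refine ⟨(⟨y, s⟩ : ElementObj A), hy, m, fun r₀ => ?_, fun r₀ r₁ k => ElementHom.ext (hac r₀ r₁ k)⟩
  exact (isHomLift_iff_map_comp_eqToHom (X := elements A) (x := E r₀) (y := ⟨y, s⟩)
      (descentDatum_obj_over D r₀) hy _ (m r₀)).2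
    ((isHomLift_iff_map_comp_eqToHom _ hy _ _).1 (ha r₀))

theorem IsStack.elements (hY : IsStack J Y)
    (hA : Presieve.IsSheaf (totalTopology J hY.isFiberedInGroupoids) A) :
    IsStack J (elements A) where
  isFiberedInGroupoids := isFiberedInGroupoids_elements hY.isFiberedInGroupoids
  isomsFormSheaf := isomsFormSheaf_elements hY hA
  effective _ _ hR D := effective_elements hY hA hR D

end

/-! ### Test spaces from represented sheaves, and the two equivalences -/

section

variable {J : GrothendieckTopology C}

/-- The sheaf on the total category of `Y` represented by `y`. -/
noncomputable def representedSheaf (J : GrothendieckTopology C) (hY : IsFiberedInGroupoids Y)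
    (y : Y.obj) : Y.objᵒᵖ ⥤ Type (u + 1) :=
  -- The lift to `Type (u + 1)` makes room for sheafification on a site whose objects form a type in
  -- that universe.
  (totalTopology J hY).sheafify (uliftYoneda.{u + 1}.obj y)

theorem representedSheaf_isSheaf (hY : IsFiberedInGroupoids Y) (y : Y.obj) :
    Presieve.IsSheaf (totalTopology J hY) (representedSheaf J hY y) :=
  (isSheaf_iff_isSheaf_of_type _ _).1 (GrothendieckTopology.sheafify_isSheaf _ _)

/-- An arrow to `y` as a section of the presheaf represented by `y`. -/
def uliftYonedaSection {y z : Y.obj} (b : z ⟶ y) : (uliftYoneda.{u + 1}.obj y).obj (op z) :=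
  ULift.up b

/-- The section of the sheaf represented by `y` given by an arrow to `y`. -/
noncomputable def representedSection (J : GrothendieckTopology C) (hY : IsFiberedInGroupoids Y)
    {y z : Y.obj} (b : z ⟶ y) : (representedSheaf J hY y).obj (op z) :=
  ((totalTopology J hY).toSheafify (uliftYoneda.{u + 1}.obj y)).app (op z) (uliftYonedaSection b)

theorem map_representedSection (hY : IsFiberedInGroupoids Y) {y z z' : Y.obj} (c : z' ⟶ z)
    (b : z ⟶ y) : (representedSheaf J hY y).map c.op (representedSection J hY b) =
      representedSection J hY (c ≫ b) :=
  (ConcreteCategory.congr_hom (((totalTopology J hY).toSheafify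
    (uliftYoneda.{u + 1}.obj y)).naturality c.op) (uliftYonedaSection b)).symm

theorem exists_mem_of_representedSection_eq (hY : IsFiberedInGroupoids Y) {y z : Y.obj}
    {b b' : z ⟶ y} (h : representedSection J hY b = representedSection J hY b') :
    ∃ W ∈ totalTopology J hY z, ∀ ⦃z' : Y.obj⦄ (c : z' ⟶ z), W c → c ≫ b = c ≫ b' := by
  refine ⟨_, Presheaf.equalizerSieve_mem (totalTopology J hY)
    ((totalTopology J hY).toSheafify (uliftYoneda.{u + 1}.obj y))
    (X := op z) (uliftYonedaSection b) (uliftYonedaSection b') h,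
    fun z' c hc => ?_⟩
  rw [Presheaf.equalizerSieve_apply] at hc
  exact congrArg ULift.down hc

theorem exists_mem_representedSection (hY : IsFiberedInGroupoids Y) {y z : Y.obj}
    (t : (representedSheaf J hY y).obj (op z)) :
    ∃ W ∈ totalTopology J hY z, ∀ ⦃z' : Y.obj⦄ (c : z' ⟶ z), W c →
      ∃ b : z' ⟶ y, (representedSheaf J hY y).map c.op t = representedSection J hY b := by
  refine ⟨_, Presheaf.imageSieve_mem (totalTopology J hY)
    ((totalTopology J hY).toSheafify (uliftYoneda.{u + 1}.obj y)) (U := op z) t,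
    fun z' c ⟨b, hb⟩ => ⟨b.down, hb.symm⟩⟩

/-- Locally the element of the target is an arrow `b` to `y`. A vertical automorphism `v` preserving
it satisfies `v ≫ b = b` after further localization, and cancelling the cartesian `b` gives `v = 𝟙`.
-/
theorem hasThinFibers_elements_representedSheaf (hY : IsStack J Y) (y : Y.obj) :
    HasThinFibers (elements (representedSheaf J hY.isFiberedInGroupoids y)) := by
  have hYg := hY.isFiberedInGroupoids
  intro s t m n hmn
  change ElementHom s t at m n
  change Y.p.map m.hom = Y.p.map n.hom at hmn
  obtain ⟨W, hW, hWt⟩ := exists_mem_representedSection hYg t.elt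
  refine ElementHom.ext (hY.hom_ext_of_mem hmn
    ((totalTopology J hYg).pullback_stable m.hom hW) fun z a ha => ?_)
  obtain ⟨b, hb⟩ := hWt (a ≫ m.hom) ha
  -- `v` measures the difference of `m` and `n` over `a`; it preserves the class of `b` because both
  -- arrows pull the element of `t` back to that of `s`.
  obtain ⟨v, ⟨hv, hvn⟩, -⟩ := hYg.existsUnique_factor (a ≫ n.hom) (a ≫ m.hom) (𝟙 _)
    (by simp [hmn])
  have hb' : representedSection J hYg b = representedSection J hYg (v ≫ b) := by
    have hmn' : (representedSheaf J hYg y).map (a ≫ n.hom).op t.elt =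
        (representedSheaf J hYg y).map (a ≫ m.hom).op t.elt := by
      rw [op_comp, op_comp, Functor.map_comp_apply, Functor.map_comp_apply, n.w, m.w]
    rw [← map_representedSection, ← hb, ← hmn', ← Functor.map_comp_apply, ← op_comp, hvn, hmn']
  obtain ⟨V, hV, hVb⟩ := exists_mem_of_representedSection_eq hYg hb'
  have hv1 : v = 𝟙 z := hY.hom_ext_of_mem (by simp [hv]) hV fun z' c hc =>
    hYg.hom_ext b (by simp [hv]) (by rw [Category.assoc, ← hVb c hc, Category.comp_id])
  rw [← hvn, hv1, Category.id_comp]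

/-- The sheaf represented by `f(x')` has the tautological section `𝟙` there, so its space of
elements contains a lift of `f(v)`, and representability is tested on it. -/
theorem isFiberwiseFaithful_of_isRepresentableBySpaces (hY : IsStack J Y) {f : BasedFunctor X Y}
    (hf : IsRepresentableBySpaces J f) : IsFiberwiseFaithful f := by
  have hYg := hY.isFiberedInGroupoids
  intro x x' v w hp hvw
  let A := representedSheaf J hYg (f.obj x')
  let s' : ElementObj A := ⟨f.obj x', representedSection J hYg (𝟙 _)⟩
  let s : ElementObj A := ⟨f.obj x, A.map (f.map v).op s'.elt⟩
  let m : s ⟶ s' := ⟨f.map v, rfl⟩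
  have hm : (elements A).p.IsHomLift (X.p.map v) m :=
    have : Y.p.IsHomLift (X.p.map v) ((elementsForget A).map m) :=
      inferInstanceAs (Y.p.IsHomLift (X.p.map v) (f.map v))
    (elementsForget A).isHomLift_map (X.p.map v) m
  have hthin := (hf _ ((hY.elements (representedSheaf_isSheaf hYg (f.obj x'))).isSpace
    (hasThinFibers_elements_representedSheaf hY (f.obj x'))) (elementsForget A)).hasThinFibers
  let P : FiberProductObj (elementsForget A) f :=
    ⟨X.p.obj x, s, x, f.w_obj x, rfl, Iso.refl _, IsHomLift.id (f.w_obj x)⟩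
  let Q : FiberProductObj (elementsForget A) f :=
    ⟨X.p.obj x', s', x', f.w_obj x', rfl, Iso.refl _, IsHomLift.id (f.w_obj x')⟩
  let φ : P ⟶ Q := ⟨X.p.map v, m, v, hm, inferInstance,
    (Category.comp_id (f.map v)).trans (Category.id_comp (f.map v)).symm⟩
  -- The same `m` serves for `w`, precisely because `f(v) = f(w)`.
  let φ' : P ⟶ Q := ⟨X.p.map v, m, w, hm, hp ▸ inferInstance,
    (Category.comp_id (f.map v)).trans (hvw.trans (Category.id_comp (f.map w)).symm)⟩
  exact congrArg FiberProductHom.right (hthin φ φ' rfl)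

theorem isSpace_iff_isInjective_diagonal (hX : IsStack J X) :
    IsSpace J X ↔ IsInjective (diagonal X) := by
  rw [isInjective_diagonal_iff hX.isFiberedInGroupoids]
  exact ⟨fun h => h.hasThinFibers, hX.isSpace⟩

theorem isRepresentableBySpaces_iff_isInjective_relativeDiagonal (hX : IsStack J X)
    (hY : IsStack J Y) (f : BasedFunctor X Y) :
    IsRepresentableBySpaces J f ↔ IsInjective (relativeDiagonal f) := by
  rw [isInjective_relativeDiagonal_iff hX.isFiberedInGroupoids hY.isFiberedInGroupoids]
  exact ⟨isFiberwiseFaithful_of_isRepresentableBySpaces hY, fun h F hF g =>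
    (hF.isStack.fiberProduct hX hY).isSpace (hasThinFibers_fiberProduct hF.hasThinFibers h)⟩

end

end FiberedStack

theorem mainTheorem12 :
    (∀ X : BasedCategory.{u, u + 1} Superscheme.{u}, IsSuperstack X →
      (IsSuperspace X ↔ FiberedStack.IsInjective (FiberedStack.diagonal X))) ∧
    (∀ X Y : BasedCategory.{u, u + 1} Superscheme.{u}, IsSuperstack X → IsSuperstack Y →
      ∀ f : BasedFunctor X Y,
        (IsRepresentableBySuperspaces f ↔
          FiberedStack.IsInjective (FiberedStack.relativeDiagonal f))) :=
  ⟨fun _ hX => FiberedStack.isSpace_iff_isInjective_diagonal hX, fun _ _ hX hY f =>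
    FiberedStack.isRepresentableBySpaces_iff_isInjective_relativeDiagonal hX hY f⟩
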